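/- Let $d\ge 2$ and let $p=(p_1,\dots,p_d)\in[0,1]^d$ be a probability vector with $p_j<1$ for all $j$. Consider the random $d$-ary labelled tree in which a node with label $n\ge2$ has children with labels $(I_1,\dots,I_d)\sim\mathrm{Mult}(n,p)$ (independently for different nodes, given their labels), and nodes with label $0$ or $1$ have no children. The CRI length $l_n$ of $d$-ary SICTA started from $n$ users is given by $l_0=l_1=1$ and, for $n\ge2$, $$l_n=\mathbf 1\{M<d\}+\sum_{j=1}^{M} l_{I_j},\qquad M=\inf\Big\{k\in\{1,\dots,d\}:\ \sum_{j=1}^k I_j\ge n-1\Big\},$$ where $l_{I_j}$ is the length of the $j$-th subtree. Put $L_n=\mathrm E[l_n]$ and $\overline F(k)=\sum_{j=k+1}^d p_j$, with the convention $0\log 0=0$. 1. For every $n\ge 0$, $L_n$ is finite and $$L_n=1+\sum_{i=2}^n\binom ni\frac{(-1)^i(i-1)\sum_{k=0}^{d-2}\overline F(k)^i}{1-\sum_{j=1}^d p_j^i}.$$ 2. As $n\to\infty$, $$\frac{L_n}{n}=\frac{\sum_{k=0}^{d-2}\overline F(k)}{-\sum_{j=1}^d p_j\log p_j}+g_1(n)+o(1),$$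 where, with $S=\{s\in\mathbb C:\ \mathrm{Re}\,s\le-1,\ \mathrm{Im}\,s\ne0,\ \sum_{j=1}^d p_j^{-s}=1\}$ (and $0^{-s}=0$), $$g_1(n)=\sum_{k=0}^{d-2}\ \sum_{s\in S}\frac{\overline F(k)^{-s}\,n^{-s-1}\,(s+1)\,\Gamma(s)}{\sum_{j=1}^d p_j\log p_j};$$ for every $n\ge1$ the sums over $S$ converge absolutely and $g_1(n)$ is real. Moreover, if there are no positive integers $k_1,\dots,k_d$ such that the numbers $p_j^{1/k_j}$, for $j$ with $p_j>0$, are all equal, then $g_1(n)=0$ for all $n\ge1$. 3. Among all probability vectors $p\in[0,1]^d$ with all $p_j<1$, the leading term $\sum_{k=0}^{d-2}\overline F(k)\big/\big(-\sum_j p_j\log p_j\big)$ is minimized at $p^{\mathrm{bi}}$ with $p^{\mathrm{bi}}_j=2^{-\min(j,d-1)}$, where it equals $1/\log 2$ (that is, a throughput of $\log 2$ for every $d$). For $p=p^{\mathrm{bi}}$ the size of the fluctuation lies between $10^{-6}$ and $10^{-3}$: $|g_1(n)|\le10^{-3}$ for all $n\ge1$, and $|g_1(n)|\ge10^{-6}$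 for infinitely many $n$. -/

import Mathlib

open MeasureTheory Filter Topology
open scoped ENNReal

noncomputable section

namespace SICTA

/-- The random choices behind the labelled `d`-ary tree. A node of the infinite `d`-ary tree is the
word of branches (0-indexed) leading to it from the root; `ω (w, i)` is the branch that the `i`-th
user taking part in the collision at node `w` chooses there. -/
abbrev Choices (d : ℕ) : Type := List (Fin d) × ℕ → Fin d

/-- The splitting law on `Fin d`: branch `j` has probability `p j`. -/
def splitLaw {d : ℕ} (p : Fin d → ℝ) : Measure (Fin d) :=
  ∑ j, ENNReal.ofReal (p j) • Measure.dirac j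

/-- The law of the choices: all choices, of all users at all nodes, are independent with
distribution `p`. -/
def choiceLaw {d : ℕ} (p : Fin d → ℝ) : Measure (Choices d) :=
  Measure.infinitePi fun _ => splitLaw p

/-- The label of the `j`-th child of the root when the root has label `n`: the number of users among
the `n` users at the root who choose branch `j`. The vector of these labels is
multinomial with parameters `n` and `p`. -/
def childLabel {d : ℕ} (n : ℕ) (ω : Choices d) (j : Fin d) : ℕ :=
  ((Finset.range n).filter fun i => ω ([], i) = j).card

/-- The choices in the subtree below the `j`-th child of the root. -/
def subtree {d : ℕ} (j : Fin d) (ω : Choices d) : Choices d :=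
  fun v => ω (j :: v.1, v.2)

/-- The last non-skipped slot `M = inf {k ∈ {1, …, d} : I_1 + … + I_k ≥ n - 1}` of a node with label
`n ≥ 2` and child labels `I`. -/
def lastSlot {d : ℕ} (n : ℕ) (I : Fin d → ℕ) : ℕ :=
  sInf {k : ℕ | 1 ≤ k ∧ k ≤ d ∧ n - 1 ≤ ∑ j with j.val < k, I j}

/-- The part of the CRI length that comes from the first `t` generations, the root having label `n`:
the recursion `l_n = 1` for `n ≤ 1` and `l_n = 1{M < d} + ∑_{j ≤ M} l_{I_j}` for `n ≥ 2`, where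
collisions at depth `t` are not expanded and contribute nothing. It is nondecreasing in `t`. -/
def criUpTo {d : ℕ} : ℕ → ℕ → Choices d → ℕ
  | 0, n, _ => if n ≤ 1 then 1 else 0
  | t + 1, n, ω =>
    if n ≤ 1 then 1
    else
      (if lastSlot n (childLabel n ω) < d then 1 else 0) +
        ∑ j with j.val < lastSlot n (childLabel n ω),
          criUpTo t (childLabel n ω j) (subtree j ω)

/-- The CRI length `l_n` of `d`-ary SICTA, as a random variable with values in `ℕ ∪ {∞}`. -/
def criLength {d : ℕ} (n : ℕ) (ω : Choices d) : ℕ∞ :=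
  ⨆ t : ℕ, (criUpTo t n ω : ℕ∞)

/-- The mean CRI length `L_n = E[l_n]`, possibly infinite. -/
def meanCRI {d : ℕ} (p : Fin d → ℝ) (n : ℕ) : ℝ≥0∞ :=
  ∫⁻ ω, (criLength n ω : ℝ≥0∞) ∂(choiceLaw p)

/-- `F̄(k) = p_{k+1} + … + p_d`; since `p j` stands for `p_{j+1}`, this is the sum over `j ≥ k`. -/
def tailProb {d : ℕ} (p : Fin d → ℝ) (k : ℕ) : ℝ :=
  ∑ j with k ≤ j.val, p j

/-- The leading term `∑_{k=0}^{d-2} F̄(k) / (-∑_j p_j log p_j)`. -/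
def leadingTerm {d : ℕ} (p : Fin d → ℝ) : ℝ :=
  (∑ k ∈ Finset.range (d - 1), tailProb p k) / (-∑ j, p j * Real.log (p j))

/-- The poles other than `-1`: the `s` with `Re s ≤ -1` and `Im s ≠ 0` such that
`∑_j p_j^{-s} = 1`. -/
def poles {d : ℕ} (p : Fin d → ℝ) : Set ℂ :=
  {s : ℂ | s.re ≤ -1 ∧ s.im ≠ 0 ∧ ∑ j, (p j : ℂ) ^ (-s) = 1}

/-- The contribution of `s` to `f_1(n, α)`:
`α^{-s} n^{-s-1} (s + 1) Γ(s) / ∑_j p_j log p_j`. -/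
def fluctTerm {d : ℕ} (p : Fin d → ℝ) (n : ℕ) (α : ℝ) (s : ℂ) : ℂ :=
  (α : ℂ) ^ (-s) * (n : ℂ) ^ (-s - 1) * ((s + 1) * Complex.Gamma s) /
    ((∑ j, p j * Real.log (p j) : ℝ) : ℂ)

/-- The fluctuation `g_1(n) = ∑_{k=0}^{d-2} f_1(n, F̄(k))`, where `f_1(n, α)` is the sum of the
contributions of all poles. -/
def fluct {d : ℕ} (p : Fin d → ℝ) (n : ℕ) : ℂ :=
  ∑ k ∈ Finset.range (d - 1), ∑' s : poles p, fluctTerm p n (tailProb p k) s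

/-- The equation `p_1^{1/k_1} = … = p_d^{1/k_d}` has a solution in positive integers `k_j`;
branches of probability zero, which are never used, are left out. -/
def IsPeriodic {d : ℕ} (p : Fin d → ℝ) : Prop :=
  ∃ k : Fin d → ℕ, (∀ j, 0 < k j) ∧
    ∀ i j, 0 < p i → 0 < p j → p i ^ (1 / (k i : ℝ)) = p j ^ (1 / (k j : ℝ))

/-- The vector `p_j = 2^{-min(j, d-1)}`, `j = 1, …, d`. -/
def pBi (d : ℕ) (j : Fin d) : ℝ :=
  (1 / 2 : ℝ) ^ min (j.val + 1) (d - 1)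

end SICTA

end

/-!
The length of `d`-ary SICTA minus one is additive over all subtrees: a subtree with at most one user
at its root contributes nothing, whether it is skipped or not, and a node with `n` users costs one
for every `k ≤ d - 2` such that at least two of its users choose a branch `j ≥ k`
(`criUpTo_succ_sub_one`). A node whose branch word has probability `q` therefore contributes, on
average, `∑ k, P(Bin(n, F̄(k) q) ≥ 2)`. Expanding this probability in the binomial coefficients of
`n`, whose means are the factorial moments of the binomial distribution
(`integral_choose_branchCount`), and summing geometric series over the generations gives the exact
formula (`meanCRI_eq`). It says that `L_n - 1` is the sum of `P(Bin(n, x) ≥ 2)` over all `k` and all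
node masses `x = F̄(k) q` (`toReal_meanCRI_eq`).

For the asymptotics the binomial distribution is first replaced by the Poisson distribution, at the
cost of an error `o(n)` (`tendsto_treeSum_binomCollision_sub`). On a logarithmic scale the Poisson
sum per user, `treeRate`, solves a renewal equation with displacements `-log p_j` and inhomogeneity
`collisionRate`. Its solution is bounded because `K y² / (1 + y)` is a supersolution
(`abs_treeSum_le`). It is asymptotically invariant under a shift by any displacement: otherwise the
increments would be bounded away from zero along arbitrarily long arithmetic progressions, against
boundedness (`mem_asymptoticPeriods_of_renewal`). The asymptotic periods form a closed subgroup of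
`ℝ`, and the displacements generate either a dense subgroup or a lattice. In the dense case
`treeRate` converges to the inverse of the entropy (`tendsto_renewal_of_forall_mem`); in the lattice
case it approaches a periodization of `collisionRate` (`tendsto_renewal_of_lattice`).

The poles lie on `Re s = -1`, where `∑ p_j^{-s} = 1` means that `Im s` times every displacement is a
multiple of `2π` (`mem_poles_iff`). Hence there are none in the dense case, while in the lattice
case they are the nonzero frequencies of the lattice, and the fluctuation is the Fourier series of
the periodization. Poisson summation (`tsum_collisionRate_eq`) identifies the two, the Fourier
coefficients being values of the Mellin transform `-Γ(s + 2) / s` of `P(Poi(y) ≥ 2)`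
(`mellin_poissonCollision`).

That `pBi` minimizes the leading term is Gibbs' inequality with respect to `pBi`. There the
displacements generate the lattice of span `log 2`, and the fluctuation is a Fourier series in
`log₂ n` whose coefficients follow from `|Γ(1 + it)|² = πt / sinh πt`: its first harmonic has
amplitude about `1.56 * 10 ^ (-6)` and dominates all others.
-/

namespace SICTA

/-! ### Sums over the nodes of the splitting tree -/

/-- `f` summed over the children of a node of mass `x`, whose masses are `p j * x`. -/
noncomputable def splitSum {d : ℕ} (p : Fin d → ℝ) (f : ℝ → ℝ) (x : ℝ) : ℝ := ∑ j, f (p j * x)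

/-- `f` summed over all nodes of the splitting tree whose root has mass `x`, generation by
generation: the `m`-th iterate of `splitSum` is the sum over the nodes at depth `m`. -/
noncomputable def treeSum {d : ℕ} (p : Fin d → ℝ) (f : ℝ → ℝ) (x : ℝ) : ℝ :=
  ∑' m : ℕ, (splitSum p)^[m] f x

section TreeSum

variable {d : ℕ} {p : Fin d → ℝ}

lemma splitSum_iterate_succ (m : ℕ) (f : ℝ → ℝ) (x : ℝ) :
    (splitSum p)^[m + 1] f x = ∑ j, (splitSum p)^[m] f (p j * x) := by
  rw [Function.iterate_succ_apply']; rfl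

lemma abs_splitSum_iterate_le (hp : p ∈ stdSimplex ℝ (Fin d)) {f g : ℝ → ℝ} (m : ℕ) :
    ∀ x, 0 ≤ x → (∀ y, 0 ≤ y → y ≤ x → |f y| ≤ g y) →
      |(splitSum p)^[m] f x| ≤ (splitSum p)^[m] g x := by
  induction m with
  | zero => intro x hx h; exact h x hx le_rfl
  | succ m ih =>
    intro x hx h
    rw [splitSum_iterate_succ, splitSum_iterate_succ]
    refine (Finset.abs_sum_le_sum_abs _ _).trans (Finset.sum_le_sum fun j _ => ?_)
    have h1 : p j * x ≤ x := mul_le_of_le_one_left hx (mem_Icc_of_mem_stdSimplex hp j).2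
    exact ih _ (mul_nonneg (hp.1 j) hx) fun y hy hyx => h y hy (hyx.trans h1)

lemma splitSum_iterate_mul_pow (c : ℝ) (i m : ℕ) (x : ℝ) :
    (splitSum p)^[m] (fun y => c * y ^ i) x = c * (∑ j, p j ^ i) ^ m * x ^ i := by
  induction m generalizing x with
  | zero => simp
  | succ m ih =>
    rw [splitSum_iterate_succ]
    simp_rw [ih, mul_pow]
    rw [← Finset.mul_sum, ← Finset.sum_mul, pow_succ]; ring

lemma splitSum_iterate_finset_sum {ι : Type*} (s : Finset ι) (f : ι → ℝ → ℝ) (m : ℕ) (x : ℝ) :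
    (splitSum p)^[m] (fun y => ∑ i ∈ s, f i y) x = ∑ i ∈ s, (splitSum p)^[m] (f i) x := by
  induction m generalizing x with
  | zero => rfl
  | succ m ih => simp_rw [splitSum_iterate_succ, ih]; exact Finset.sum_comm

lemma splitSum_iterate_sub (f g : ℝ → ℝ) (m : ℕ) (x : ℝ) :
    (splitSum p)^[m] (fun y => f y - g y) x = (splitSum p)^[m] f x - (splitSum p)^[m] g x := by
  induction m generalizing x with
  | zero => rfl
  | succ m ih => simp_rw [splitSum_iterate_succ, ih]; exact Finset.sum_sub_distrib _ _

lemma splitSum_iterate_const_mul (c : ℝ) (f : ℝ → ℝ) (m : ℕ) (x : ℝ) :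
    (splitSum p)^[m] (fun y => c * f y) x = c * (splitSum p)^[m] f x := by
  induction m generalizing x with
  | zero => rfl
  | succ m ih => simp_rw [splitSum_iterate_succ, ih, Finset.mul_sum]

lemma splitSum_iterate_comp_mul (c : ℝ) (f : ℝ → ℝ) (m : ℕ) (x : ℝ) :
    (splitSum p)^[m] (fun y => f (c * y)) x = (splitSum p)^[m] f (c * x) := by
  induction m generalizing x with
  | zero => rfl
  | succ m ih =>
    simp_rw [splitSum_iterate_succ, ih]
    exact Finset.sum_congr rfl fun j _ => by rw [mul_left_comm]

lemma exists_pos_of_mem_stdSimplex (hp : p ∈ stdSimplex ℝ (Fin d)) : ∃ j, 0 < p j := by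
  by_contra! h
  have := hp.2 ▸ Finset.sum_nonpos fun j (_ : j ∈ Finset.univ) => h j
  linarith

lemma sum_pow_nonneg (hp : p ∈ stdSimplex ℝ (Fin d)) (i : ℕ) : 0 ≤ ∑ j, p j ^ i :=
  Finset.sum_nonneg fun j _ => pow_nonneg (hp.1 j) i

lemma sum_pow_lt_one (hp : p ∈ stdSimplex ℝ (Fin d)) (hlt : ∀ j, p j < 1) {i : ℕ} (hi : 2 ≤ i) :
    ∑ j, p j ^ i < 1 := by
  obtain ⟨j, hj⟩ := exists_pos_of_mem_stdSimplex hp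
  rw [← hp.2]
  refine Finset.sum_lt_sum (fun j _ => ?_) ⟨j, Finset.mem_univ j, ?_⟩
  · exact pow_le_of_le_one (hp.1 j) (hlt j).le (by omega)
  · exact pow_lt_self_of_lt_one₀ hj (hlt j) (by omega)

lemma abs_splitSum_iterate_le_sq (hp : p ∈ stdSimplex ℝ (Fin d)) {f : ℝ → ℝ} {C x : ℝ} (hx : 0 ≤ x)
    (hf : ∀ y, 0 ≤ y → y ≤ x → |f y| ≤ C * y ^ 2) (m : ℕ) :
    |(splitSum p)^[m] f x| ≤ C * (∑ j, p j ^ 2) ^ m * x ^ 2 :=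
  (abs_splitSum_iterate_le hp m x hx hf).trans_eq (splitSum_iterate_mul_pow C 2 m x)

lemma summable_geometric_sq (hp : p ∈ stdSimplex ℝ (Fin d)) (hlt : ∀ j, p j < 1) (C x : ℝ) :
    Summable fun m : ℕ => C * (∑ j, p j ^ 2) ^ m * x ^ 2 :=
  ((summable_geometric_of_lt_one (sum_pow_nonneg hp 2)
    (sum_pow_lt_one hp hlt le_rfl)).mul_left C).mul_right _

lemma summable_splitSum_iterate (hp : p ∈ stdSimplex ℝ (Fin d)) (hlt : ∀ j, p j < 1) {f : ℝ → ℝ}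
    {C x : ℝ} (hx : 0 ≤ x) (hf : ∀ y, 0 ≤ y → y ≤ x → |f y| ≤ C * y ^ 2) :
    Summable fun m : ℕ => (splitSum p)^[m] f x :=
  .of_norm_bounded (summable_geometric_sq hp hlt C x)
    (abs_splitSum_iterate_le_sq hp hx hf)

/-- The renewal equation of a sum over the tree. -/
lemma treeSum_eq_add_sum (hp : p ∈ stdSimplex ℝ (Fin d)) (hlt : ∀ j, p j < 1) {f : ℝ → ℝ}
    {C x : ℝ} (hx : 0 ≤ x) (hf : ∀ y, 0 ≤ y → y ≤ x → |f y| ≤ C * y ^ 2) :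
    treeSum p f x = f x + ∑ j, treeSum p f (p j * x) := by
  rw [treeSum, (summable_splitSum_iterate hp hlt hx hf).tsum_eq_zero_add]
  simp_rw [splitSum_iterate_succ]
  rw [Summable.tsum_finsetSum fun j _ => ?_]
  · rfl
  · have h1 : p j * x ≤ x := mul_le_of_le_one_left hx (hlt j).le
    exact summable_splitSum_iterate hp hlt (mul_nonneg (hp.1 j) hx)
      fun y hy hyx => hf y hy (hyx.trans h1)

lemma sum_sq_div_one_add_le (hp : p ∈ stdSimplex ℝ (Fin d)) {y : ℝ} (hy : 0 ≤ y) :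
    ∑ j, (p j * y) ^ 2 / (1 + p j * y) ≤
      y ^ 2 / (1 + y) - (1 - ∑ j, p j ^ 2) * (y / (1 + y)) ^ 2 := by
  have key : ∀ q : ℝ, 0 ≤ q → q ≤ 1 → (q * y) ^ 2 / (1 + q * y) ≤
      q * (y ^ 2 / (1 + y)) - (q - q ^ 2) * (y / (1 + y)) ^ 2 := by
    intro q h0 h1
    have hq : 0 ≤ q * y := mul_nonneg h0 hy
    have hle : q * y ≤ y := mul_le_of_le_one_left hy h1
    have e : q * (y ^ 2 / (1 + y)) - (q - q ^ 2) * (y / (1 + y)) ^ 2 - (q * y) ^ 2 / (1 + q * y)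
        = q * (1 - q) * (y ^ 2 / (1 + y) ^ 2) * ((1 - q) * y / (1 + q * y)) := by
      field_simp
      ring
    have : 0 ≤ q * (1 - q) * (y ^ 2 / (1 + y) ^ 2) * ((1 - q) * y / (1 + q * y)) := by
      have := sub_nonneg.2 h1
      positivity
    linarith
  calc _ ≤ ∑ j, (p j * (y ^ 2 / (1 + y)) - (p j - p j ^ 2) * (y / (1 + y)) ^ 2) :=
        Finset.sum_le_sum fun j _ => key _ (hp.1 j) (mem_Icc_of_mem_stdSimplex hp j).2
    _ = _ := by
      rw [Finset.sum_sub_distrib, ← Finset.sum_mul, ← Finset.sum_mul, Finset.sum_sub_distrib, hp.2]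
      ring

/-- A linear bound for sums over the tree. The function `K y² / (1 + y)` is a supersolution of the
renewal equation, so that it dominates the sums over the first generations. -/
lemma abs_treeSum_le (hp : p ∈ stdSimplex ℝ (Fin d)) (hlt : ∀ j, p j < 1) {f : ℝ → ℝ} {C : ℝ}
    (hC : 0 ≤ C) (hf : ∀ y, 0 ≤ y → |f y| ≤ C * (y / (1 + y)) ^ 2) {y : ℝ} (hy : 0 ≤ y) :
    |treeSum p f y| ≤ C / (1 - ∑ j, p j ^ 2) * (y ^ 2 / (1 + y)) := by
  set ρ := ∑ j, p j ^ 2 with hρ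
  have hρ1 : 0 < 1 - ρ := sub_pos.2 (sum_pow_lt_one hp hlt le_rfl)
  set g : ℝ → ℝ := fun y => C * (y / (1 + y)) ^ 2
  have part : ∀ M : ℕ, ∀ y, 0 ≤ y →
      ∑ m ∈ Finset.range M, (splitSum p)^[m] g y ≤ C / (1 - ρ) * (y ^ 2 / (1 + y)) := by
    intro M
    induction M with
    | zero => intro y hy; simp only [Finset.range_zero, Finset.sum_empty]; positivity
    | succ M ih =>
      intro y hy
      rw [Finset.sum_range_succ']
      simp_rw [splitSum_iterate_succ]
      rw [Finset.sum_comm]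
      calc _ ≤ ∑ j, C / (1 - ρ) * ((p j * y) ^ 2 / (1 + p j * y)) + g y := by
            refine add_le_add (Finset.sum_le_sum fun j _ => ih _ (mul_nonneg (hp.1 j) hy)) le_rfl
        _ ≤ C / (1 - ρ) * (y ^ 2 / (1 + y) - (1 - ρ) * (y / (1 + y)) ^ 2) + g y := by
            rw [← Finset.mul_sum]
            gcongr
            exact sum_sq_div_one_add_le hp hy
        _ = _ := by
            simp only [g]
            field_simp
            ring
  have hb : ∀ m, ‖(splitSum p)^[m] f y‖ ≤ (splitSum p)^[m] g y := fun m =>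
    abs_splitSum_iterate_le hp m y hy fun z hz _ => hf z hz
  have hg0 : ∀ m, 0 ≤ (splitSum p)^[m] g y := fun m => (norm_nonneg _).trans (hb m)
  have hs : Summable fun m => (splitSum p)^[m] g y :=
    summable_of_sum_range_le hg0 fun M => part M y hy
  exact (tsum_of_norm_bounded hs.hasSum hb).trans
    (Real.tsum_le_of_sum_range_le hg0 fun M => part M y hy)

end TreeSum

/-! ### Collision probabilities, binomial and Poisson -/

/-- The probability that a binomial variable with parameters `n` and `x` is at least two, written
as a polynomial in `x`; see `binomCollision_eq` for the closed form. -/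
noncomputable def binomCollision (n : ℕ) (x : ℝ) : ℝ :=
  ∑ i ∈ Finset.Icc 2 n, (n.choose i : ℝ) * ((-1) ^ i * ((i : ℝ) - 1)) * x ^ i

/-- The probability that a Poisson variable with mean `y` is at least two. -/
noncomputable def poissonCollision (y : ℝ) : ℝ := 1 - Real.exp (-y) * (1 + y)

lemma sum_range_mul_choose_mul_pow (n : ℕ) (y : ℝ) :
    ∑ i ∈ Finset.range (n + 1), (i : ℝ) * (n.choose i : ℝ) * y ^ i
      = n * y * (1 + y) ^ (n - 1) := by
  rcases n with _ | n
  · simp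
  rw [Finset.sum_range_succ', add_comm 1 y, Nat.add_sub_cancel, add_pow, Finset.mul_sum]
  simp only [Nat.cast_zero, zero_mul, add_zero]
  refine Finset.sum_congr rfl fun i _ => ?_
  have := Nat.add_one_mul_choose_eq n i
  have h : ((n : ℝ) + 1) * n.choose i = (n + 1).choose (i + 1) * ((i : ℝ) + 1) := by
    exact_mod_cast this
  push_cast
  rw [one_pow, mul_one, pow_succ]
  linear_combination (-(y ^ i * y)) * h

lemma binomCollision_eq (n : ℕ) (x : ℝ) :
    binomCollision n x = 1 - (1 - x) ^ n - n * x * (1 - x) ^ (n - 1) := by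
  rcases Nat.eq_zero_or_pos n with rfl | hn
  · simp [binomCollision]
  have hr : Finset.range (n + 1) = insert 0 (insert 1 (Finset.Icc 2 n)) := by
    ext i; simp; omega
  have h1 : ∑ i ∈ Finset.range (n + 1), (n.choose i : ℝ) * ((-1) ^ i * ((i : ℝ) - 1)) * x ^ i
      = -1 + binomCollision n x := by
    rw [hr, Finset.sum_insert (by simp), Finset.sum_insert (by simp), binomCollision]
    simp
  have h2 : ∑ i ∈ Finset.range (n + 1), (n.choose i : ℝ) * ((-1) ^ i * ((i : ℝ) - 1)) * x ^ i
      = n * (-x) * (1 + -x) ^ (n - 1) - (-x + 1) ^ n := by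
    rw [← sum_range_mul_choose_mul_pow, add_pow, ← Finset.sum_sub_distrib]
    refine Finset.sum_congr rfl fun i _ => ?_
    rw [neg_pow x, one_pow]
    ring
  rw [h2] at h1
  have e : (1 : ℝ) - x = 1 + -x := by ring
  rw [e, add_comm (1 : ℝ) (-x)] at *
  linarith

lemma binomCollision_one (n : ℕ) : binomCollision n 1 = if 2 ≤ n then 1 else 0 := by
  rw [binomCollision_eq]
  rcases n with _ | _ | n <;> simp

lemma poissonCollision_nonneg (y : ℝ) : 0 ≤ poissonCollision y := by
  have h := mul_le_mul_of_nonneg_left (Real.add_one_le_exp y) (Real.exp_pos (-y)).le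
  rw [← Real.exp_add, neg_add_cancel, Real.exp_zero, add_comm] at h
  exact sub_nonneg.2 h

lemma poissonCollision_le_one {y : ℝ} (hy : 0 ≤ y) : poissonCollision y ≤ 1 :=
  sub_le_self _ (mul_nonneg (Real.exp_pos _).le (add_nonneg zero_le_one hy))

lemma poissonCollision_le_sq {y : ℝ} (hy : 0 ≤ y) : poissonCollision y ≤ y ^ 2 := by
  have h := mul_le_mul_of_nonneg_right (Real.add_one_le_exp (-y)) (by positivity : 0 ≤ 1 + y)
  unfold poissonCollision
  nlinarith

lemma abs_poissonCollision_le_sq {y : ℝ} (hy : 0 ≤ y) : |poissonCollision y| ≤ 1 * y ^ 2 := by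
  rw [abs_of_nonneg (poissonCollision_nonneg y), one_mul]
  exact poissonCollision_le_sq hy

lemma min_one_sq_le {y : ℝ} (hy : 0 ≤ y) : min 1 (y ^ 2) ≤ 4 * (y / (1 + y)) ^ 2 := by
  rw [div_pow, mul_div_assoc', le_div_iff₀ (by positivity)]
  rcases le_total y 1 with h | h
  · calc _ ≤ y ^ 2 * (1 + y) ^ 2 := by gcongr; exact min_le_right _ _
      _ ≤ _ := by nlinarith [sq_nonneg y, mul_nonneg (sq_nonneg y) hy]
  · calc _ ≤ 1 * (1 + y) ^ 2 := by gcongr; exact min_le_left _ _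
      _ ≤ _ := by nlinarith

lemma abs_poissonCollision_le {y : ℝ} (hy : 0 ≤ y) :
    |poissonCollision y| ≤ 4 * (y / (1 + y)) ^ 2 := by
  rw [abs_of_nonneg (poissonCollision_nonneg y)]
  exact (le_min (poissonCollision_le_one hy) (poissonCollision_le_sq hy)).trans (min_one_sq_le hy)

lemma continuous_poissonCollision : Continuous poissonCollision := by
  unfold poissonCollision; fun_prop

lemma mul_exp_neg_le_one (t : ℝ) : t * Real.exp (-t) ≤ 1 := by
  have h := mul_le_mul_of_nonneg_right ((le_add_of_nonneg_right zero_le_one).trans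
    (Real.add_one_le_exp t)) (Real.exp_pos (-t)).le
  rwa [← Real.exp_add, add_neg_cancel, Real.exp_zero] at h

/-- Poisson approximation of the binomial collision probability. -/
lemma abs_binomCollision_sub_le (n : ℕ) {x : ℝ} (h0 : 0 ≤ x) (h1 : x ≤ 1) :
    |binomCollision n x - poissonCollision (n * x)| ≤ 5 * n * x ^ 2 := by
  have ha : 0 ≤ 1 - x := sub_nonneg.2 h1
  have hle : 1 - x ≤ Real.exp (-x) := by have := Real.add_one_le_exp (-x); linarith
  have hdiff : |(1 - x) - Real.exp (-x)| ≤ x ^ 2 := by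
    have := Real.abs_exp_sub_one_sub_id_le (x := -x) (by rwa [abs_neg, abs_of_nonneg h0])
    rw [abs_sub_comm]
    convert this using 1
    · ring_nf
    · ring
  have hexp : ∀ m : ℕ, Real.exp (-(m * x)) = Real.exp (-x) ^ m := fun m => by
    rw [← Real.exp_nat_mul]; ring_nf
  have hpow : ∀ m : ℕ, |(1 - x) ^ m - Real.exp (-(m * x))| ≤
      x ^ 2 * m * Real.exp (-x) ^ (m - 1) := by
    intro m
    rw [hexp]
    refine (abs_pow_sub_pow_le _ _ _).trans ?_
    rw [abs_of_nonneg ha, abs_of_pos (Real.exp_pos _), max_eq_right hle]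
    gcongr
  have hA : |(1 - x) ^ n - Real.exp (-(n * x))| ≤ n * x ^ 2 := by
    refine (hpow n).trans ?_
    have : Real.exp (-x) ^ (n - 1) ≤ 1 :=
      pow_le_one₀ (Real.exp_pos _).le (Real.exp_le_one_iff.2 (by linarith))
    calc _ ≤ x ^ 2 * n * 1 := by gcongr
      _ = _ := by ring
  have hB : n * x * |(1 - x) ^ (n - 1) - Real.exp (-(n * x))| ≤ n * x * (4 * x) := by
    rcases n with _ | m
    · simp
    refine mul_le_mul_of_nonneg_left ?_ (by positivity)
    rw [Nat.add_sub_cancel]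
    have e1 : |(1 - x) ^ m - Real.exp (-(m * x))| ≤ 3 * x := by
      refine (hpow m).trans ?_
      rcases m with _ | k
      · simp; linarith
      rw [Nat.add_sub_cancel]
      have e2 : Real.exp (-x) ^ k = Real.exp (-((k + 1 : ℕ) * x)) * Real.exp x := by
        rw [hexp, pow_succ, mul_assoc, ← Real.exp_add]; simp
      have e3 := mul_exp_neg_le_one ((k + 1 : ℕ) * x)
      have e4 : Real.exp x ≤ 3 :=
        (Real.exp_le_exp.2 h1).trans (Real.exp_one_lt_d9.le.trans (by norm_num))
      calc x ^ 2 * (k + 1 : ℕ) * Real.exp (-x) ^ k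
          = x * ((k + 1 : ℕ) * x * Real.exp (-((k + 1 : ℕ) * x))) * Real.exp x := by
            rw [e2]; ring
        _ ≤ x * 1 * 3 := by gcongr
        _ = _ := by ring
    have e5 : |Real.exp (-(m * x)) - Real.exp (-((m + 1 : ℕ) * x))| ≤ x := by
      have e6 : Real.exp (-((m + 1 : ℕ) * x)) = Real.exp (-(m * x)) * Real.exp (-x) := by
        rw [← Real.exp_add]; push_cast; ring_nf
      have e7 : Real.exp (-(m * x)) ≤ 1 := Real.exp_le_one_iff.2 (by
        have : 0 ≤ (m : ℝ) * x := by positivity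
        linarith)
      have e8 : Real.exp (-x) ≤ 1 := Real.exp_le_one_iff.2 (by linarith)
      have e9 := Real.exp_pos (-(m * x))
      rw [e6, abs_of_nonneg (by nlinarith)]
      nlinarith
    have := abs_sub_le ((1 - x) ^ m) (Real.exp (-(m * x))) (Real.exp (-((m + 1 : ℕ) * x)))
    linarith
  have e : binomCollision n x - poissonCollision (n * x) =
      -((1 - x) ^ n - Real.exp (-(n * x)))
        - n * x * ((1 - x) ^ (n - 1) - Real.exp (-(n * x))) := by
    rw [binomCollision_eq, poissonCollision]; ring
  rw [e]
  refine (abs_sub _ _).trans ?_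
  rw [abs_neg, abs_mul, abs_of_nonneg (by positivity : 0 ≤ n * x)]
  nlinarith

lemma abs_binomCollision_le (n : ℕ) {x : ℝ} (h0 : 0 ≤ x) (h1 : x ≤ 1) :
    |binomCollision n x| ≤ (5 * n + n ^ 2) * x ^ 2 := by
  have h2 := abs_binomCollision_sub_le n h0 h1
  have h3 := abs_poissonCollision_le_sq (y := n * x) (by positivity)
  have h4 := abs_sub_abs_le_abs_sub (binomCollision n x) (poissonCollision (n * x))
  nlinarith

section

variable {d : ℕ} {p : Fin d → ℝ}

lemma treeSum_binomCollision (hp : p ∈ stdSimplex ℝ (Fin d)) (hlt : ∀ j, p j < 1) (n : ℕ) (x : ℝ) :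
    treeSum p (binomCollision n) x =
      ∑ i ∈ Finset.Icc 2 n, (n.choose i : ℝ) *
        ((-1) ^ i * ((i : ℝ) - 1) * x ^ i / (1 - ∑ j, p j ^ i)) := by
  unfold treeSum binomCollision
  simp_rw [splitSum_iterate_finset_sum, splitSum_iterate_mul_pow]
  refine (hasSum_sum fun i hi => ?_).tsum_eq
  have hi2 : 2 ≤ i := (Finset.mem_Icc.1 hi).1
  have := ((hasSum_geometric_of_lt_one (sum_pow_nonneg hp i)
    (sum_pow_lt_one hp hlt hi2)).mul_left
      ((n.choose i : ℝ) * ((-1) ^ i * ((i : ℝ) - 1)))).mul_right (x ^ i)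
  rw [show (n.choose i : ℝ) * ((-1) ^ i * ((i : ℝ) - 1) * x ^ i / (1 - ∑ j, p j ^ i)) =
    (n.choose i : ℝ) * ((-1) ^ i * ((i : ℝ) - 1)) * (1 - ∑ j, p j ^ i)⁻¹ * x ^ i by ring]
  exact this

/-- Depoissonization: the sums over the tree of the binomial and of the Poisson collision
probabilities differ by `o(n)`. -/
lemma tendsto_treeSum_binomCollision_sub (hp : p ∈ stdSimplex ℝ (Fin d)) (hlt : ∀ j, p j < 1)
    {x : ℝ} (h0 : 0 ≤ x) (h1 : x ≤ 1) :
    Tendsto (fun n : ℕ => (treeSum p (binomCollision n) x - treeSum p poissonCollision (n * x)) / n)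
      atTop (𝓝 0) := by
  have hbin : ∀ n : ℕ, ∀ y, 0 ≤ y → y ≤ x → |binomCollision n y| ≤ (5 * n + n ^ 2) * y ^ 2 :=
    fun n y h h' => abs_binomCollision_le n h (h'.trans h1)
  have hpoi : ∀ n : ℕ, ∀ y, 0 ≤ y → y ≤ x → |poissonCollision (n * y)| ≤ (n : ℝ) ^ 2 * y ^ 2 :=
    fun n y h _ => by
      simpa [mul_pow] using abs_poissonCollision_le_sq (y := n * y) (by positivity)
  have key : ∀ n : ℕ, (treeSum p (binomCollision n) x - treeSum p poissonCollision (n * x)) / n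
      = ∑' m : ℕ, (splitSum p)^[m]
          (fun y => binomCollision n y - poissonCollision (n * y)) x / n := by
    intro n
    rw [tsum_div_const]
    congr 1
    simp_rw [splitSum_iterate_sub]
    rw [(summable_splitSum_iterate hp hlt h0 (hbin n)).tsum_sub
      (summable_splitSum_iterate hp hlt h0 (hpoi n))]
    simp_rw [treeSum, splitSum_iterate_comp_mul]
  simp_rw [key]
  rw [← tsum_zero (α := ℝ) (β := ℕ)]
  refine tendsto_tsum_of_dominated_convergence
    (bound := fun m => 5 * (∑ j, p j ^ 2) ^ m * x ^ 2) (summable_geometric_sq hp hlt 5 x)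
    (fun m => ?_) (Eventually.of_forall fun n m => ?_)
  · -- each generation has finitely many nodes, each contributing at most a constant
    have hb : ∀ n : ℕ, |(splitSum p)^[m]
        (fun y => binomCollision n y - poissonCollision (n * y)) x| ≤
          (splitSum p)^[m] (fun _ => 4) x := by
      intro n
      refine abs_splitSum_iterate_le hp m x h0 fun y hy hyx => ?_
      have hy1 : y ≤ 1 := hyx.trans h1
      have e1 : 0 ≤ (1 - y) ^ n := pow_nonneg (by linarith) n
      have e2 : (1 - y) ^ n ≤ 1 := pow_le_one₀ (by linarith) (by linarith)
      have e3 : 0 ≤ n * y * (1 - y) ^ (n - 1) := by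
        have : 0 ≤ 1 - y := by linarith
        positivity
      have e4 : n * y * (1 - y) ^ (n - 1) ≤ 2 := by
        rcases n with _ | k
        · simp
        rw [Nat.add_sub_cancel]
        have hle : 1 - y ≤ Real.exp (-y) := by have := Real.add_one_le_exp (-y); linarith
        have h5 : (1 - y) ^ k ≤ Real.exp (-(k * y)) := by
          calc (1 - y) ^ k ≤ Real.exp (-y) ^ k := by
                have : 0 ≤ 1 - y := by linarith
                gcongr
            _ = _ := by rw [← Real.exp_nat_mul]; ring_nf
        have h6 := mul_exp_neg_le_one (k * y)
        have h7 : (1 - y) ^ k ≤ 1 := pow_le_one₀ (by linarith) (by linarith)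
        have h8 : 0 ≤ (1 - y) ^ k := pow_nonneg (by linarith) k
        have h9 : (k : ℝ) * y * (1 - y) ^ k ≤ 1 :=
          (mul_le_mul_of_nonneg_left h5 (by positivity)).trans h6
        push_cast
        nlinarith
      have e5 := poissonCollision_nonneg (n * y)
      have e6 := poissonCollision_le_one (y := n * y) (by positivity)
      rw [binomCollision_eq, abs_le]
      constructor <;> linarith
    have hl := tendsto_const_div_atTop_nhds_zero_nat ((splitSum p)^[m] (fun _ => (4 : ℝ)) x)
    refine squeeze_zero_norm (fun n => ?_) hl
    rw [norm_div, Real.norm_natCast]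
    gcongr
    exact hb n
  · rw [norm_div, Real.norm_natCast]
    rcases Nat.eq_zero_or_pos n with rfl | hn
    · rw [Nat.cast_zero, div_zero]
      have := sum_pow_nonneg hp 2
      positivity
    rw [div_le_iff₀ (by positivity)]
    refine (abs_splitSum_iterate_le_sq hp h0
      (fun y hy hyx => abs_binomCollision_sub_le n hy (hyx.trans h1)) m).trans_eq ?_
    ring

end

/-! ### Renewal theory -/

/-- The shifts that asymptotically leave `f` unchanged. -/
def asymptoticPeriods (f : ℝ → ℝ) : AddSubgroup ℝ where
  carrier := {c | Tendsto (fun x => f (x + c) - f x) atTop (𝓝 0)}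
  zero_mem' := by simp
  add_mem' {a b} ha hb := by
    have := (ha.comp (tendsto_atTop_add_const_right atTop b tendsto_id)).add hb
    simp only [add_zero] at this
    refine this.congr fun x => ?_
    simp only [Function.comp_apply, id]
    rw [show x + (a + b) = x + b + a by ring]
    ring
  neg_mem' {a} ha := by
    have := (ha.comp (tendsto_atTop_add_const_right atTop (-a) tendsto_id)).neg
    simp only [neg_zero] at this
    refine this.congr fun x => ?_
    simp

lemma mem_asymptoticPeriods {f : ℝ → ℝ} {c : ℝ} :
    c ∈ asymptoticPeriods f ↔ Tendsto (fun x => f (x + c) - f x) atTop (𝓝 0) := Iff.rfl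

lemma isClosed_asymptoticPeriods {f : ℝ → ℝ} (hf : UniformContinuous f) :
    IsClosed (asymptoticPeriods f : Set ℝ) := by
  refine isClosed_of_closure_subset fun c hc => ?_
  rw [SetLike.mem_coe, mem_asymptoticPeriods, Metric.tendsto_nhds]
  intro ε hε
  obtain ⟨δ, hδ, h⟩ := Metric.uniformContinuous_iff.1 hf (ε / 2) (half_pos hε)
  obtain ⟨c', hc', hcc'⟩ := Metric.mem_closure_iff.1 hc δ hδ
  filter_upwards [Metric.tendsto_nhds.1 (mem_asymptoticPeriods.1 hc') (ε / 2) (half_pos hε)]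
    with x hx
  have h1 : dist (f (x + c)) (f (x + c')) < ε / 2 := h (by rwa [dist_add_left])
  rw [Real.dist_eq] at hx h1 ⊢
  have := abs_sub_le (f (x + c) - f x) (f (x + c') - f x) 0
  rw [sub_sub_sub_cancel_right] at this
  linarith

/-- If a bounded solution `E` of a renewal equation with vanishing inhomogeneity is close to its
limit superior somewhere, then it is so at any given number of points further left, in steps of a
possible displacement `a j`. -/
lemma frequently_forall_le_of_renewal {d : ℕ} {p a : Fin d → ℝ} (hp : p ∈ stdSimplex ℝ (Fin d))
    {E e : ℝ → ℝ} (hE : ∀ x, E x = e x + ∑ i, p i * E (x - a i)) (he : Tendsto e atTop (𝓝 0))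
    {η : ℝ} (hle : ∀ δ > 0, ∀ᶠ x in atTop, E x ≤ η + δ)
    (hfr : ∀ δ > 0, ∃ᶠ x in atTop, η - δ ≤ E x) {j : Fin d} (hj : 0 < p j) (N : ℕ) :
    ∀ δ > 0, ∃ᶠ x in atTop, ∀ i ≤ N, η - δ ≤ E (x - i * a j) := by
  induction N with
  | zero =>
    intro δ hδ
    refine (hfr δ hδ).mono fun x hx i hi => ?_
    obtain rfl : i = 0 := by omega
    simpa using hx
  | succ N ih =>
    intro δ hδ
    have hj1 : p j ≤ 1 := (mem_Icc_of_mem_stdSimplex hp j).2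
    -- `E` is at most `η + δ'` at the ends of all other steps, so `p j * E` at the end of the step
    -- `a j` falls short of `p j * η` by less than `4 * δ' = p j * δ`
    set δ' := p j * δ / 4 with hδ'
    have hδ'0 : 0 < δ' := by positivity
    have hδ'le : δ' ≤ δ := by rw [hδ']; nlinarith
    have hshift : ∀ c : ℝ, Tendsto (fun x : ℝ => x - c) atTop atTop := fun c =>
      tendsto_atTop_add_const_right atTop (-c) tendsto_id
    have h1 : ∀ᶠ x in atTop, e (x - N * a j) < δ' :=
      (he.comp (hshift _)).eventually_lt_const hδ'0
    have h2 : ∀ᶠ x in atTop, ∀ i, E (x - N * a j - a i) ≤ η + δ' :=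
      eventually_all.2 fun i => ((hshift (a i)).comp (hshift (N * a j))).eventually (hle δ' hδ'0)
    refine ((ih δ' hδ'0).and_eventually (h1.and h2)).mono fun x ⟨hx, hx1, hx2⟩ i hi => ?_
    rcases Nat.lt_or_ge N i with hiN | hiN
    · obtain rfl : i = N + 1 := by omega
      have h3 := hx N le_rfl
      rw [hE, ← Finset.add_sum_erase _ _ (Finset.mem_univ j)] at h3
      have h4 : ∑ i ∈ Finset.univ.erase j, p i * E (x - N * a j - a i) ≤ (1 - p j) * (η + δ') := by
        rw [← hp.2, ← Finset.add_sum_erase _ _ (Finset.mem_univ j), add_sub_cancel_left,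
          Finset.sum_mul]
        exact Finset.sum_le_sum fun i _ => mul_le_mul_of_nonneg_left (hx2 i) (hp.1 i)
      rw [show x - (N + 1 : ℕ) * a j = x - N * a j - a j by push_cast; ring]
      have h5 : p j * (η - δ) ≤ p j * E (x - N * a j - a j) := by
        have : p j * δ = 4 * δ' := by rw [hδ']; ring
        nlinarith
      exact le_of_mul_le_mul_left h5 hj
    · exact le_trans (by linarith) (hx i hiN)

/-- A bounded solution of a renewal equation with vanishing inhomogeneity, whose sums along the
steps of a possible displacement are bounded, is asymptotically nonpositive. -/
lemma eventually_le_of_renewal {d : ℕ} {p a : Fin d → ℝ} (hp : p ∈ stdSimplex ℝ (Fin d))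
    {E e : ℝ → ℝ} (hE : ∀ x, E x = e x + ∑ i, p i * E (x - a i)) (he : Tendsto e atTop (𝓝 0))
    {j : Fin d} (hj : 0 < p j) {B : ℝ} (hB : ∀ x, |E x| ≤ B)
    (hsum : ∀ N : ℕ, ∀ x, ∑ i ∈ Finset.range N, E (x - i * a j) ≤ B) {ε : ℝ} (hε : 0 < ε) :
    ∀ᶠ x in atTop, E x ≤ ε := by
  by_contra hcon
  -- a positive limit superior makes arbitrarily long sums in steps of `a j` large
  have hbd : IsBoundedUnder (· ≤ ·) atTop E := isBoundedUnder_of ⟨B, fun x => (abs_le.1 (hB x)).2⟩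
  have hbd' : IsBoundedUnder (· ≥ ·) atTop E :=
    isBoundedUnder_of ⟨-B, fun x => (abs_le.1 (hB x)).1⟩
  set η := limsup E atTop
  have hη : ε ≤ η := le_limsup_of_frequently_le
    ((not_eventually.1 hcon).mono fun x hx => (not_le.1 hx).le) hbd
  have hle : ∀ δ > 0, ∀ᶠ x in atTop, E x ≤ η + δ := fun δ hδ =>
    (eventually_lt_of_limsup_lt (lt_add_of_pos_right η hδ) hbd).mono fun x hx => hx.le
  have hfr : ∀ δ > 0, ∃ᶠ x in atTop, η - δ ≤ E x := fun δ hδ =>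
    (frequently_lt_of_lt_limsup hbd'.isCoboundedUnder_le (sub_lt_self η hδ)).mono fun x hx => hx.le
  obtain ⟨N, hN⟩ := exists_nat_gt (B / (η / 2))
  rw [div_lt_iff₀ (by linarith)] at hN
  obtain ⟨x, hx⟩ :=
    (frequently_forall_le_of_renewal hp hE he hle hfr hj N (η / 2) (by linarith)).exists
  have h1 : ∑ _i ∈ Finset.range N, η / 2 ≤ ∑ i ∈ Finset.range N, E (x - i * a j) :=
    Finset.sum_le_sum fun i hi => by
      have := hx i (Finset.mem_range.1 hi).le
      linarith
  rw [Finset.sum_const, Finset.card_range, nsmul_eq_mul] at h1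
  linarith [hsum N x]

/-- The displacements with positive probability are asymptotic periods of a bounded solution of a
renewal equation. -/
lemma mem_asymptoticPeriods_of_renewal {d : ℕ} {p a : Fin d → ℝ} (hp : p ∈ stdSimplex ℝ (Fin d))
    {D g : ℝ → ℝ} (hD : ∀ x, D x = g x + ∑ i, p i * D (x - a i)) (hg : Tendsto g atTop (𝓝 0))
    {B : ℝ} (hB : ∀ x, |D x| ≤ B) {j : Fin d} (hj : 0 < p j) :
    a j ∈ asymptoticPeriods D := by
  have hg' : Tendsto (fun x => g (x + a j) - g x) atTop (𝓝 0) := by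
    simpa using (hg.comp (tendsto_atTop_add_const_right atTop (a j) tendsto_id)).sub hg
  have hE : ∀ x, D (x + a j) - D x =
      (g (x + a j) - g x) + ∑ i, p i * (D (x - a i + a j) - D (x - a i)) := by
    intro x
    simp_rw [mul_sub]
    rw [Finset.sum_sub_distrib, hD (x + a j)]
    conv_lhs => rw [hD x]
    simp_rw [sub_add_eq_add_sub]
    ring
  have hbd : ∀ x y, D x - D y ≤ 2 * B := fun x y => by
    linarith [(abs_le.1 (hB x)).2, (abs_le.1 (hB y)).1]
  have htel : ∀ N : ℕ, ∀ x, ∑ i ∈ Finset.range N, (D (x - i * a j + a j) - D (x - i * a j)) =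
      D (x + a j) - D (x - N * a j + a j) := by
    intro N x
    have := Finset.sum_range_sub' (fun i : ℕ => D (x - i * a j + a j)) N
    simp only [Nat.cast_zero, zero_mul, sub_zero] at this
    rw [← this]
    refine Finset.sum_congr rfl fun i _ => ?_
    congr 2
    push_cast; ring
  have up : ∀ ε > 0, ∀ᶠ x in atTop, D (x + a j) - D x ≤ ε := fun ε hε =>
    eventually_le_of_renewal (E := fun x => D (x + a j) - D x) hp hE hg' hj
      (fun x => abs_le.2 ⟨by linarith [hbd x (x + a j)], hbd _ _⟩)
      (fun N x => (htel N x).trans_le (hbd _ _)) hε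
  have low : ∀ ε > 0, ∀ᶠ x in atTop, -(D (x + a j) - D x) ≤ ε := fun ε hε =>
    eventually_le_of_renewal (E := fun x => -(D (x + a j) - D x))
      (e := fun x => -(g (x + a j) - g x)) (a := a) (B := 2 * B) hp
      (fun x => by
        rw [hE x, neg_add, ← Finset.sum_neg_distrib]
        simp_rw [mul_neg]) (by simpa using hg'.neg) hj
      (fun x => abs_le.2 ⟨by linarith [hbd (x + a j) x], by linarith [hbd x (x + a j)]⟩)
      (fun N x => by
        rw [Finset.sum_neg_distrib, htel, neg_sub]
        exact hbd _ _) hε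
  rw [mem_asymptoticPeriods, Metric.tendsto_nhds]
  intro ε hε
  filter_upwards [up (ε / 2) (half_pos hε), low (ε / 2) (half_pos hε)] with x h1 h2
  rw [Real.dist_eq, sub_zero, abs_lt]
  constructor <;> linarith

/-- The limit of a solution of a renewal equation when all shifts are asymptotic periods. Here `Φ`
is the antiderivative of the inhomogeneity that vanishes at `-∞`. -/
lemma tendsto_renewal_of_forall_mem {d : ℕ} {p a : Fin d → ℝ} (hp : p ∈ stdSimplex ℝ (Fin d))
    {D g Φ : ℝ → ℝ} (hD : ∀ x, D x = g x + ∑ i, p i * D (x - a i)) (hDc : Continuous D)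
    (hD0 : Tendsto D atBot (𝓝 0)) (hΦ : ∀ x, HasDerivAt Φ (g x) x)
    (hΦ0 : Tendsto Φ atBot (𝓝 0)) {c : ℝ} (hΦ1 : Tendsto Φ atTop (𝓝 c))
    {B : ℝ} (hB : ∀ x, |D x| ≤ B) (hall : ∀ v, v ∈ asymptoticPeriods D) :
    Tendsto (fun x => (∑ i, p i * a i) * D x) atTop (𝓝 c) := by
  have hsub : ∀ x, (∑ i, p i * ∫ v in (0 : ℝ)..a i, D (x - v)) =
      ∑ i, p i * ((∫ u in (0 : ℝ)..x, D u) - ∫ u in (0 : ℝ)..(x - a i), D u) := by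
    intro x
    refine Finset.sum_congr rfl fun i _ => ?_
    rw [intervalIntegral.integral_comp_sub_left (fun u => D u) x, sub_zero,
      intervalIntegral.integral_interval_sub_left (hDc.intervalIntegrable _ _)
        (hDc.intervalIntegrable _ _)]
  have hder : ∀ x, HasDerivAt (fun x => ∑ i, p i * ∫ v in (0 : ℝ)..a i, D (x - v)) (g x) x := by
    intro x
    simp_rw [hsub]
    have h1 : ∀ y, HasDerivAt (fun x => ∫ u in (0 : ℝ)..x, D u) (D y) y := fun y =>
      intervalIntegral.integral_hasDerivAt_right (hDc.intervalIntegrable _ _)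
        (hDc.stronglyMeasurableAtFilter _ _) hDc.continuousAt
    have h2 : HasDerivAt
        (fun x => ∑ i, p i * ((∫ u in (0 : ℝ)..x, D u) - ∫ u in (0 : ℝ)..(x - a i), D u))
        (∑ i, p i * (D x - D (x - a i))) x :=
      .fun_sum fun i _ => ((h1 x).sub ((h1 (x - a i)).comp_sub_const x (a i))).const_mul (p i)
    convert! h2 using 1
    simp_rw [mul_sub]
    rw [Finset.sum_sub_distrib, ← Finset.sum_mul, hp.2, one_mul, eq_sub_iff_add_eq, ← hD]
  have hlim : ∀ l : Filter ℝ, l.IsCountablyGenerated → ∀ f : ℝ → ℝ → ℝ, (∀ x, Continuous (f x)) →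
      (∀ x v, |f x v| ≤ 2 * B) → (∀ v, Tendsto (fun x => f x v) l (𝓝 0)) →
      Tendsto (fun x => ∑ i, p i * ∫ v in (0 : ℝ)..a i, f x v) l (𝓝 0) := by
    intro l hl f hfc hfB hf
    have : Tendsto (fun x => ∑ i, p i * ∫ v in (0 : ℝ)..a i, f x v) l
        (𝓝 (∑ i, p i * ∫ v in (0 : ℝ)..a i, (0 : ℝ))) := by
      refine tendsto_finsetSum _ fun i _ => Tendsto.const_mul _ ?_
      exact intervalIntegral.tendsto_integral_filter_of_dominated_convergence (fun _ => 2 * B)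
        (Eventually.of_forall fun x => (hfc x).aestronglyMeasurable)
        (Eventually.of_forall fun x => Eventually.of_forall fun v _ => hfB x v)
        (by simp) (Eventually.of_forall fun v _ => hf v)
    simpa using this
  have hB0 : 0 ≤ B := (abs_nonneg _).trans (hB 0)
  have hbot : Tendsto (fun x => ∑ i, p i * ∫ v in (0 : ℝ)..a i, D (x - v)) atBot (𝓝 0) :=
    hlim atBot inferInstance (fun x v => D (x - v)) (fun x => by fun_prop)
      (fun x v => (hB _).trans (by linarith)) fun v =>
        hD0.comp (tendsto_atBot_add_const_right atBot (-v) tendsto_id)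
  have htop : Tendsto (fun x => ∑ i, p i * ∫ v in (0 : ℝ)..a i, (D x - D (x - v))) atTop (𝓝 0) :=
    hlim atTop inferInstance (fun x v => D x - D (x - v)) (fun x => by fun_prop)
      (fun x v => (abs_sub _ _).trans (by linarith [hB x, hB (x - v)])) fun v => by
        have := (mem_asymptoticPeriods.1 (hall (-v))).neg
        simpa [sub_eq_add_neg, add_comm] using this
  -- both sides have the derivative `g` and vanish at `-∞`
  have heq : ∀ x, ∑ i, p i * ∫ v in (0 : ℝ)..a i, D (x - v) = Φ x := by
    have hconst : ∀ x y, (∑ i, p i * ∫ v in (0 : ℝ)..a i, D (x - v)) - Φ x =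
        (∑ i, p i * ∫ v in (0 : ℝ)..a i, D (y - v)) - Φ y :=
      is_const_of_deriv_eq_zero (fun x => ((hder x).sub (hΦ x)).differentiableAt)
        fun x => ((hder x).sub (hΦ x)).deriv.trans (sub_self _)
    intro x
    have h0 := hbot.sub hΦ0
    rw [sub_zero] at h0
    have := tendsto_nhds_unique (h0.congr fun y => hconst y x) tendsto_const_nhds
    linarith
  have := htop.add hΦ1
  rw [zero_add] at this
  refine this.congr fun x => ?_
  rw [← heq, ← Finset.sum_add_distrib, Finset.sum_mul]
  refine Finset.sum_congr rfl fun i _ => ?_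
  have hc : Continuous fun v => D (x - v) := by fun_prop
  rw [intervalIntegral.integral_sub (by simp) (hc.intervalIntegrable _ _)]
  simp only [intervalIntegral.integral_const, smul_eq_mul, sub_zero]
  ring

/-- The limiting behaviour of a solution of a renewal equation when all displacements are multiples
of `h`. -/
lemma tendsto_renewal_of_lattice {d : ℕ} {p : Fin d → ℝ} (hp : p ∈ stdSimplex ℝ (Fin d)) {h : ℝ}
    (hh : 0 < h) {k : Fin d → ℕ} {D g : ℝ → ℝ} (hg : ∀ x, 0 ≤ g x)
    (hD : ∀ x, D x = g x + ∑ i, p i * D (x - k i * h))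
    (hD0 : Tendsto D atBot (𝓝 0)) (hmem : h ∈ asymptoticPeriods D) :
    Tendsto (fun x => (∑ i, p i * k i) * D x - ∑' i : ℕ, g (x - i * h)) atTop (𝓝 0) := by
  -- `V` telescopes along the lattice, with increments `g`
  set V : ℝ → ℝ := fun x => ∑ j, p j * ∑ i ∈ Finset.range (k j), D (x - i * h) with hV
  have hstep : ∀ x, V x - V (x - h) = g x := by
    intro x
    simp only [hV]
    rw [← Finset.sum_sub_distrib]
    have : ∀ j, p j * ∑ i ∈ Finset.range (k j), D (x - i * h) -
        p j * ∑ i ∈ Finset.range (k j), D (x - h - i * h) = p j * D x - p j * D (x - k j * h) := by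
      intro j
      rw [← mul_sub, ← mul_sub, ← Finset.sum_sub_distrib]
      have := Finset.sum_range_sub' (fun i : ℕ => D (x - i * h)) (k j)
      simp only [Nat.cast_zero, zero_mul, sub_zero] at this
      rw [← this]
      congr 1
      refine Finset.sum_congr rfl fun i _ => ?_
      congr 2
      push_cast; ring
    simp_rw [this]
    rw [Finset.sum_sub_distrib, ← Finset.sum_mul, hp.2, one_mul, sub_eq_iff_eq_add, ← hD]
  have hpart : ∀ N : ℕ, ∀ x, ∑ i ∈ Finset.range N, g (x - i * h) = V x - V (x - N * h) := by
    intro N x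
    have := Finset.sum_range_sub' (fun i : ℕ => V (x - i * h)) N
    simp only [Nat.cast_zero, zero_mul, sub_zero] at this
    rw [← this]
    refine Finset.sum_congr rfl fun i _ => ?_
    rw [← hstep]
    congr 2
    push_cast; ring
  have hV0 : Tendsto V atBot (𝓝 0) := by
    have : Tendsto V atBot (𝓝 (∑ j, p j * ∑ i ∈ Finset.range (k j), (0 : ℝ))) :=
      tendsto_finsetSum _ fun j _ => Tendsto.const_mul _ <| tendsto_finsetSum _ fun i _ =>
        hD0.comp (tendsto_atBot_add_const_right atBot (-(i * h)) tendsto_id)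
    simpa using this
  have hsum : ∀ x, ∑' i : ℕ, g (x - i * h) = V x := by
    intro x
    refine ((hasSum_iff_tendsto_nat_of_nonneg (fun i => hg _) _).2 ?_).tsum_eq
    simp_rw [hpart]
    have : Tendsto (fun N : ℕ => x - N * h) atTop atBot :=
      tendsto_atBot_add_const_left _ _ (tendsto_neg_atTop_atBot.comp
        (tendsto_natCast_atTop_atTop.atTop_mul_const hh))
    simpa using tendsto_const_nhds.sub (hV0.comp this)
  have hlim : Tendsto (fun x => ∑ j, p j * ∑ i ∈ Finset.range (k j), (D x - D (x - i * h)))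
      atTop (𝓝 (∑ j, p j * ∑ i ∈ Finset.range (k j), (0 : ℝ))) := by
    refine tendsto_finsetSum _ fun j _ => Tendsto.const_mul _ <| tendsto_finsetSum _ fun i _ => ?_
    have h1 : -((i : ℕ) • h) ∈ asymptoticPeriods D :=
      neg_mem (AddSubgroup.nsmul_mem _ hmem i)
    have := (mem_asymptoticPeriods.1 h1).neg
    simpa [sub_eq_add_neg, add_comm] using this
  simp only [Finset.sum_const_zero, mul_zero] at hlim
  refine hlim.congr fun x => ?_
  rw [hsum]
  simp only [hV]
  rw [Finset.sum_mul, ← Finset.sum_sub_distrib]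
  refine Finset.sum_congr rfl fun j _ => ?_
  rw [Finset.sum_sub_distrib, Finset.sum_const, Finset.card_range, nsmul_eq_mul]
  ring

/-! ### The Mellin transform of the Poisson collision probability -/

lemma norm_Gamma_one_add_mul_I_sq {t : ℝ} (ht : t ≠ 0) :
    ‖Complex.Gamma (1 + t * Complex.I)‖ ^ 2 = Real.pi * t / Real.sinh (Real.pi * t) := by
  have ht' : (t : ℂ) * Complex.I ≠ 0 := mul_ne_zero (by exact_mod_cast ht) Complex.I_ne_zero
  have h1 := Complex.Gamma_mul_Gamma_one_sub (t * Complex.I)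
  have h2 := Complex.Gamma_add_one _ ht'
  have h3 : (starRingEnd ℂ) (Complex.Gamma (1 + t * Complex.I)) =
      Complex.Gamma (1 - t * Complex.I) := by
    rw [← Complex.Gamma_conj]; simp [sub_eq_add_neg]
  have hs : (Real.sinh (Real.pi * t) : ℂ) ≠ 0 := by
    rw [Ne, Complex.ofReal_eq_zero, Real.sinh_eq_zero]
    exact mul_ne_zero Real.pi_ne_zero ht
  have h4 : ((‖Complex.Gamma (1 + t * Complex.I)‖ ^ 2 : ℝ) : ℂ) =
      ((Real.pi * t / Real.sinh (Real.pi * t) : ℝ) : ℂ) := by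
    rw [Complex.ofReal_pow, ← Complex.mul_conj', h3, add_comm, h2, mul_assoc, h1, ← mul_assoc,
      Complex.sin_mul_I]
    push_cast at hs ⊢
    field_simp [Complex.I_ne_zero]
  exact_mod_cast h4

/-- This follows from `sinh y = 4 sinh (y / 4) cosh (y / 4) cosh (y / 2)`. -/
lemma mul_exp_le_sinh {y : ℝ} (hy : 0 ≤ y) : y * Real.exp (3 * y / 4) ≤ 4 * Real.sinh y := by
  have h1 : Real.sinh y = 4 * Real.sinh (y / 4) * Real.cosh (y / 4) * Real.cosh (y / 2) := by
    rw [show y = 2 * (2 * (y / 4)) by ring, Real.sinh_two_mul, Real.sinh_two_mul]; ring_nf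
  have hc : ∀ x, Real.exp x / 2 ≤ Real.cosh x := fun x => by
    rw [Real.cosh_eq]; linarith [Real.exp_pos (-x)]
  have hs : y / 4 ≤ Real.sinh (y / 4) := Real.self_le_sinh_iff.2 (by linarith)
  have he : Real.exp (3 * y / 4) = Real.exp (y / 4) * Real.exp (y / 2) := by
    rw [← Real.exp_add]; ring_nf
  rw [h1, he]
  calc y * (Real.exp (y / 4) * Real.exp (y / 2))
      = 4 * (4 * (y / 4) * (Real.exp (y / 4) / 2) * (Real.exp (y / 2) / 2)) := by ring
    _ ≤ _ := by
      have := hc (y / 4)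
      have := hc (y / 2)
      have := Real.cosh_pos (y / 4)
      have h0 : 0 ≤ y / 4 := by linarith
      have := h0.trans hs
      gcongr

lemma norm_Gamma_one_add_mul_I_le (t : ℝ) :
    ‖Complex.Gamma (1 + t * Complex.I)‖ ≤ 2 * Real.exp (-(3 * Real.pi / 8 * |t|)) := by
  rcases eq_or_ne t 0 with rfl | ht
  · simp
  refine le_of_sq_le_sq ?_ (by positivity)
  rw [norm_Gamma_one_add_mul_I_sq ht]
  have hy : 0 < Real.pi * |t| := mul_pos Real.pi_pos (abs_pos.2 ht)
  have h1 : Real.pi * t / Real.sinh (Real.pi * t) =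
      Real.pi * |t| / Real.sinh (Real.pi * |t|) := by
    rcases abs_choice t with h | h <;> rw [h]
    rw [mul_neg, Real.sinh_neg, neg_div_neg_eq]
  rw [h1, div_le_iff₀ (Real.sinh_pos_iff.2 hy), mul_pow, ← Real.exp_nat_mul]
  have h2 := mul_exp_le_sinh hy.le
  have h3 : Real.exp ((2 : ℕ) * -(3 * Real.pi / 8 * |t|)) *
      Real.exp (3 * (Real.pi * |t|) / 4) = 1 := by
    rw [← Real.exp_add, ← Real.exp_zero]; congr 1; push_cast; ring
  calc Real.pi * |t| = Real.exp ((2 : ℕ) * -(3 * Real.pi / 8 * |t|)) *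
        (Real.pi * |t| * Real.exp (3 * (Real.pi * |t|) / 4)) := by
        rw [mul_left_comm, h3, mul_one]
    _ ≤ Real.exp ((2 : ℕ) * -(3 * Real.pi / 8 * |t|)) * (4 * Real.sinh (Real.pi * |t|)) := by gcongr
    _ = _ := by ring

lemma hasDerivAt_poissonCollision (y : ℝ) :
    HasDerivAt poissonCollision (y * Real.exp (-y)) y := by
  have h1 : HasDerivAt (fun y => Real.exp (-y)) (Real.exp (-y) * -1) y :=
    (hasDerivAt_neg y).exp
  have h2 : HasDerivAt (fun y : ℝ => 1 + y) 1 y := (hasDerivAt_id y).const_add 1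
  have := (h1.mul h2).const_sub 1
  convert! this using 1
  ring

lemma mellinConvergent_poissonCollision {s : ℂ} (hs : s.re = -1) :
    MellinConvergent (fun y => (poissonCollision y : ℂ)) s := by
  refine mellinConvergent_of_isBigO_rpow (a := 0) (b := -2) ?_ ?_ (by rw [hs]; norm_num) ?_
    (by rw [hs]; norm_num)
  · exact (Complex.continuous_ofReal.comp
      continuous_poissonCollision).locallyIntegrable.locallyIntegrableOn _
  · refine Asymptotics.IsBigO.of_bound 1 ?_
    filter_upwards [eventually_ge_atTop 0] with y hy
    simpa [abs_of_nonneg (poissonCollision_nonneg y)] using poissonCollision_le_one hy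
  · refine Asymptotics.IsBigO.of_bound 1 ?_
    filter_upwards [self_mem_nhdsWithin] with y hy
    have hy' : 0 ≤ y := (Set.mem_Ioi.1 hy).le
    rw [neg_neg, Complex.norm_real, Real.norm_eq_abs, Real.norm_eq_abs,
      abs_of_nonneg (Real.rpow_nonneg hy' _), Real.rpow_two]
    exact abs_poissonCollision_le_sq hy'

/-- Integration by parts reduces the Mellin transform to Euler's integral. -/
lemma mellin_poissonCollision {s : ℂ} (hs : s.re = -1) :
    mellin (fun y => (poissonCollision y : ℂ)) s = -(Complex.Gamma (s + 2) / s) := by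
  have hs0 : s ≠ 0 := by rintro rfl; norm_num at hs
  set F : ℝ → ℂ := fun y => (poissonCollision y : ℂ) * ((y : ℂ) ^ s / s) with hF
  have hnorm : ∀ y : ℝ, 0 < y → ‖F y‖ = poissonCollision y * (y⁻¹ / ‖s‖) := by
    intro y hy
    rw [hF, norm_mul, norm_div, Complex.norm_real, Real.norm_eq_abs,
      abs_of_nonneg (poissonCollision_nonneg y), Complex.norm_cpow_eq_rpow_re_of_pos hy, hs,
      Real.rpow_neg_one]
  have hG : IntegrableOn (fun y : ℝ => (Real.exp (-y) : ℂ) * (y : ℂ) ^ (s + 2 - 1)) (Set.Ioi 0) :=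
    Complex.GammaIntegral_convergent (by simp [hs])
  have hM : IntegrableOn (fun y : ℝ => (y : ℂ) ^ (s - 1) • (poissonCollision y : ℂ)) (Set.Ioi 0) :=
    mellinConvergent_poissonCollision hs
  have hder : ∀ y ∈ Set.Ioi (0 : ℝ), HasDerivAt F
      ((Real.exp (-y) : ℂ) * (y : ℂ) ^ (s + 2 - 1) / s +
        (y : ℂ) ^ (s - 1) • (poissonCollision y : ℂ)) y := by
    intro y hy
    have hy0 : (y : ℂ) ≠ 0 := by exact_mod_cast (Set.mem_Ioi.1 hy).ne'
    have h1 := (hasDerivAt_poissonCollision y).ofReal_comp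
    have h2 := hasDerivAt_ofReal_cpow_const (Set.mem_Ioi.1 hy).ne' hs0
    have h3 := h1.mul (h2.div_const s)
    convert! h3 using 1
    have e1 : (y : ℂ) ^ (s + 2 - 1) = y * (y : ℂ) ^ s := by
      rw [show s + 2 - 1 = s + 1 by ring, Complex.cpow_add _ _ hy0, Complex.cpow_one, mul_comm]
    rw [e1, smul_eq_mul, mul_div_cancel_left₀ _ hs0]
    push_cast
    ring
  have hbot : Tendsto F (𝓝[>] 0) (𝓝 0) := by
    have hl : Tendsto (fun y : ℝ => y / ‖s‖) (𝓝[>] 0) (𝓝 0) := by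
      have : Tendsto (fun y : ℝ => y / ‖s‖) (𝓝 0) (𝓝 (0 / ‖s‖)) := tendsto_id.div_const _
      rw [zero_div] at this
      exact this.mono_left nhdsWithin_le_nhds
    refine squeeze_zero_norm' ?_ hl
    filter_upwards [self_mem_nhdsWithin] with y hy
    have hy' : 0 < y := hy
    rw [hnorm y hy']
    calc _ ≤ y ^ 2 * (y⁻¹ / ‖s‖) := by gcongr; exact poissonCollision_le_sq hy'.le
      _ = _ := by field_simp
  have htop : Tendsto F atTop (𝓝 0) := by
    have hl : Tendsto (fun y : ℝ => y⁻¹ / ‖s‖) atTop (𝓝 0) := by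
      simpa using tendsto_inv_atTop_zero.div_const ‖s‖
    refine squeeze_zero_norm' ?_ hl
    filter_upwards [eventually_gt_atTop 0] with y hy
    rw [hnorm y hy]
    calc _ ≤ 1 * (y⁻¹ / ‖s‖) := by gcongr; exact poissonCollision_le_one hy.le
      _ = _ := one_mul _
  have hcont : ContinuousWithinAt F (Set.Ici 0) 0 := by
    refine continuousWithinAt_Ioi_iff_Ici.1 ?_
    have : F 0 = 0 := by simp [hF, poissonCollision]
    rw [ContinuousWithinAt, this]
    exact hbot
  have hint := integral_Ioi_of_hasDerivAt_of_tendsto hcont hder ((hG.div_const s).add hM) htop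
  have hF0 : F 0 = 0 := by simp [hF, poissonCollision]
  rw [hF0, sub_zero, integral_add (hG.div_const s) hM, integral_div] at hint
  rw [mellin, eq_neg_iff_add_eq_zero, add_comm, Complex.Gamma_eq_integral (by simp [hs])]
  exact hint

/-! ### Poisson summation -/

/-- The Poisson collision probability per user, as a function of the logarithm of the mean number of
users. -/
noncomputable def collisionRate (u : ℝ) : ℝ := poissonCollision (Real.exp u) * Real.exp (-u)

lemma collisionRate_nonneg (u : ℝ) : 0 ≤ collisionRate u :=
  mul_nonneg (poissonCollision_nonneg _) (Real.exp_pos _).le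

lemma continuous_collisionRate : Continuous collisionRate := by
  have := continuous_poissonCollision
  unfold collisionRate; fun_prop

lemma collisionRate_le_exp_neg (u : ℝ) : collisionRate u ≤ Real.exp (-u) :=
  mul_le_of_le_one_left (Real.exp_pos _).le (poissonCollision_le_one (Real.exp_pos _).le)

lemma collisionRate_le_exp (u : ℝ) : collisionRate u ≤ Real.exp u := by
  calc collisionRate u ≤ Real.exp u ^ 2 * Real.exp (-u) := by
        unfold collisionRate; gcongr; exact poissonCollision_le_sq (Real.exp_pos _).le
    _ = Real.exp u := by rw [sq, mul_assoc, ← Real.exp_add]; simp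

lemma collisionRate_le_exp_neg_abs (u : ℝ) : collisionRate u ≤ Real.exp (-|u|) := by
  rcases abs_choice u with h | h <;> rw [h]
  · exact collisionRate_le_exp_neg u
  · rw [neg_neg]; exact collisionRate_le_exp u

/-- The Fourier coefficients, in the Mellin variable, of the periodization of `collisionRate` with
period `h`. -/
noncomputable def rateCoeff (h : ℝ) (m : ℤ) : ℂ :=
  mellin (fun y => (poissonCollision y : ℂ)) (-1 + (2 * Real.pi * m / h : ℝ) * Complex.I)

lemma rateCoeff_eq (h : ℝ) (m : ℤ) :
    rateCoeff h m = -(Complex.Gamma (1 + (2 * Real.pi * m / h : ℝ) * Complex.I) /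
      (-1 + (2 * Real.pi * m / h : ℝ) * Complex.I)) := by
  rw [rateCoeff, mellin_poissonCollision (by simp)]
  ring_nf

lemma rateCoeff_zero (h : ℝ) : rateCoeff h 0 = 1 := by
  rw [rateCoeff_eq]; simp

lemma norm_rateCoeff_le {h : ℝ} (hh : 0 < h) (m : ℤ) :
    ‖rateCoeff h m‖ ≤ 2 * Real.exp (-(3 * Real.pi ^ 2 / (4 * h))) ^ m.natAbs := by
  rw [rateCoeff_eq, norm_neg, norm_div]
  set t : ℝ := 2 * Real.pi * m / h with ht
  have h1 : 1 ≤ ‖(-1 + t * Complex.I : ℂ)‖ := by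
    refine le_trans ?_ (Complex.abs_re_le_norm _)
    simp
  refine (div_le_self (norm_nonneg _) h1).trans ((norm_Gamma_one_add_mul_I_le t).trans_eq ?_)
  rw [← Real.exp_nat_mul, ht, abs_div, abs_mul, abs_of_pos Real.two_pi_pos, abs_of_pos hh,
    Nat.cast_natAbs, Int.cast_abs]
  congr 2
  field_simp
  ring

lemma summable_pow_natAbs {r : ℝ} (h0 : 0 ≤ r) (h1 : r < 1) :
    Summable fun m : ℤ => r ^ m.natAbs :=
  .of_nat_of_neg (by simpa using summable_geometric_of_lt_one h0 h1)
    (by simpa using summable_geometric_of_lt_one h0 h1)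

lemma summable_norm_rateCoeff {h : ℝ} (hh : 0 < h) : Summable fun m : ℤ => ‖rateCoeff h m‖ :=
  .of_nonneg_of_le (fun _ => norm_nonneg _) (norm_rateCoeff_le hh)
    ((summable_pow_natAbs (Real.exp_pos _).le
      (Real.exp_lt_one_iff.2 (neg_lt_zero.2 (by have := Real.pi_pos; positivity)))).mul_left 2)

/-- Poisson summation for `collisionRate`. -/
lemma tsum_collisionRate_eq {h : ℝ} (hh : 0 < h) (x : ℝ) :
    ((h * ∑' i : ℤ, collisionRate (x - i * h) : ℝ) : ℂ) =
      ∑' m : ℤ, rateCoeff h m * Complex.exp (-((2 * Real.pi * m / h * x : ℝ) * Complex.I)) := by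
  set f : ℝ → ℂ := fun v => (collisionRate (-(h * v)) : ℂ) with hf
  have hfc : Continuous f := by
    have := continuous_collisionRate
    fun_prop
  -- the Mellin transform of `y ↦ poissonCollision (y ^ h)` is the Fourier transform of `f`
  have hfourier : ∀ m : ℤ, FourierTransform.fourier f (m : ℝ) = (h : ℂ)⁻¹ * rateCoeff h m := by
    intro m
    have h1 := mellin_eq_fourier (fun y : ℝ => (poissonCollision (y ^ h) : ℂ))
      (s := -h + (2 * Real.pi * m : ℝ) * Complex.I)
    have h2 := mellin_comp_rpow (fun y : ℝ => (poissonCollision y : ℂ))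
      (-h + (2 * Real.pi * m : ℝ) * Complex.I) h
    rw [h2] at h1
    have e1 : (-h + (2 * Real.pi * m : ℝ) * Complex.I : ℂ) / h =
        -1 + (2 * Real.pi * m / h : ℝ) * Complex.I := by
      have : (h : ℂ) ≠ 0 := by exact_mod_cast hh.ne'
      push_cast
      field_simp
    have e2 : (-h + (2 * Real.pi * m : ℝ) * Complex.I : ℂ).re = -h := by simp
    have e3 : (-h + (2 * Real.pi * m : ℝ) * Complex.I : ℂ).im = 2 * Real.pi * m := by simp
    rw [e1, e2, e3, neg_neg, abs_of_pos hh, mul_div_cancel_left₀ _ Real.two_pi_pos.ne'] at h1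
    have e4 : f = fun u : ℝ => Real.exp (h * u) • (poissonCollision (Real.exp (-u) ^ h) : ℂ) := by
      funext u
      simp only [hf, collisionRate]
      rw [← Real.exp_mul, neg_neg, Complex.real_smul, ← Complex.ofReal_mul, mul_comm]
      congr 4
      ring
    rw [e4, ← h1, rateCoeff, Complex.real_smul, Complex.ofReal_inv]
  have hbig : f =O[cocompact ℝ] fun v : ℝ => |v| ^ (-(2 : ℝ)) := by
    refine Asymptotics.IsBigO.of_bound (2 / h ^ 2) ?_
    filter_upwards [(Filter.hasBasis_cocompact.mem_of_mem (isCompact_singleton (x := (0 : ℝ))))]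
      with v hv
    have hv0 : v ≠ 0 := hv
    have h1 := collisionRate_le_exp_neg_abs (-(h * v))
    have h2 : 0 < |h * v| := abs_pos.2 (mul_ne_zero hh.ne' hv0)
    have h3 := Real.quadratic_le_exp_of_nonneg h2.le
    rw [hf, Complex.norm_real, Real.norm_eq_abs, abs_of_nonneg (collisionRate_nonneg _),
      Real.norm_eq_abs, abs_of_nonneg (Real.rpow_nonneg (abs_nonneg _) _),
      Real.rpow_neg (abs_nonneg _), Real.rpow_two, sq_abs]
    rw [abs_neg, Real.exp_neg] at h1
    refine h1.trans ?_
    have h4 : h ^ 2 * v ^ 2 / 2 ≤ Real.exp |h * v| := by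
      have : |h * v| ^ 2 = h ^ 2 * v ^ 2 := by rw [sq_abs, mul_pow]
      linarith
    calc _ ≤ (h ^ 2 * v ^ 2 / 2)⁻¹ := by
          have : 0 < h ^ 2 * v ^ 2 / 2 := by positivity
          gcongr
      _ = _ := by field_simp
  have hsum : Summable fun m : ℤ => FourierTransform.fourier f (m : ℝ) := by
    simp_rw [hfourier]
    exact (summable_norm_rateCoeff hh).of_norm.mul_left _
  have hP := Real.tsum_eq_tsum_fourier_of_rpow_decay_of_summable hfc one_lt_two hbig hsum (-(x / h))
  have hL : ∀ i : ℤ, f (-(x / h) + i) = ((collisionRate (x - i * h) : ℝ) : ℂ) := by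
    intro i
    simp only [hf]
    congr 2
    field_simp
    ring
  simp_rw [hL, hfourier] at hP
  rw [Complex.ofReal_mul, Complex.ofReal_tsum, hP, ← tsum_mul_left]
  refine tsum_congr fun m => ?_
  have hh' : (h : ℂ) ≠ 0 := by exact_mod_cast hh.ne'
  rw [fourier_coe_apply, ← mul_assoc, ← mul_assoc, mul_inv_cancel₀ hh', one_mul]
  congr 2
  push_cast
  field_simp

/-! ### The poles -/

section Poles

variable {d : ℕ} {p : Fin d → ℝ}

lemma re_ofReal_cpow_neg {q : ℝ} (hq : 0 < q) (s : ℂ) :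
    ((q : ℂ) ^ (-s)).re = q ^ (-s.re) * Real.cos (s.im * Real.log q) := by
  rw [Complex.cpow_def_of_ne_zero (by exact_mod_cast hq.ne'), ← Complex.ofReal_log hq.le,
    Complex.exp_re, Complex.re_ofReal_mul, Complex.im_ofReal_mul, Real.rpow_def_of_pos hq,
    Complex.neg_re, Complex.neg_im, mul_neg, mul_neg, Real.cos_neg, mul_comm s.im]

lemma ne_zero_of_mem_poles {s : ℂ} (hs : s ∈ poles p) : s ≠ 0 := by
  rintro rfl; exact hs.2.1 rfl

/-- All poles lie on the line `Re s = -1`, where `∑ p_j^{-s}` can be `1` only if every term has the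
phase `0`. -/
lemma mem_poles_iff (hp : p ∈ stdSimplex ℝ (Fin d)) (hlt : ∀ j, p j < 1) {s : ℂ} :
    s ∈ poles p ↔ s.re = -1 ∧ s.im ≠ 0 ∧
      ∀ j, 0 < p j → ∃ m : ℤ, m * (2 * Real.pi) = s.im * Real.log (p j) := by
  constructor
  · intro hs
    have hs0 := ne_zero_of_mem_poles hs
    obtain ⟨hre, him, hsum⟩ := hs
    have hle : ∀ j ∈ Finset.univ, ((p j : ℂ) ^ (-s)).re ≤ p j := by
      intro j _
      rcases (hp.1 j).eq_or_lt with h0 | h0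
      · rw [← h0]; simp [hs0]
      · rw [re_ofReal_cpow_neg h0]
        calc _ ≤ p j ^ (-s.re) * 1 := by gcongr; exact Real.cos_le_one _
          _ ≤ p j ^ (1 : ℝ) := by
            rw [mul_one]
            exact Real.rpow_le_rpow_of_exponent_ge h0 (hlt j).le (by linarith)
          _ = p j := Real.rpow_one _
    have heq : ∑ j, ((p j : ℂ) ^ (-s)).re = ∑ j, p j := by
      rw [← Complex.re_sum, hsum, hp.2, Complex.one_re]
    have hall := (Finset.sum_eq_sum_iff_of_le hle).1 heq
    have hre1 : s.re = -1 := by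
      obtain ⟨j, hj⟩ := exists_pos_of_mem_stdSimplex hp
      by_contra hne
      have h1 : p j ^ (-s.re) < p j ^ (1 : ℝ) :=
        Real.rpow_lt_rpow_of_exponent_gt hj (hlt j) (by
          have := lt_of_le_of_ne hre hne
          linarith)
      have h2 := hall j (Finset.mem_univ j)
      rw [re_ofReal_cpow_neg hj] at h2
      rw [Real.rpow_one] at h1
      have h3 : p j ^ (-s.re) * Real.cos (s.im * Real.log (p j)) ≤ p j ^ (-s.re) * 1 := by
        gcongr; exact Real.cos_le_one _
      linarith
    refine ⟨hre1, him, fun j hj => (Real.cos_eq_one_iff _).1 ?_⟩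
    have h2 := hall j (Finset.mem_univ j)
    rw [re_ofReal_cpow_neg hj, hre1, neg_neg, Real.rpow_one] at h2
    exact (mul_eq_left₀ hj.ne').1 h2
  · rintro ⟨hre, him, hall⟩
    have hs0 : s ≠ 0 := by rintro rfl; exact him rfl
    refine ⟨hre.le, him, ?_⟩
    have : ∀ j, (p j : ℂ) ^ (-s) = p j := by
      intro j
      rcases (hp.1 j).eq_or_lt with h0 | h0
      · rw [← h0]; simp [hs0]
      · obtain ⟨m, hm⟩ := hall j h0
        have e : -s = 1 + -(s.im * Complex.I) := by
          conv_lhs => rw [← Complex.re_add_im s, hre]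
          push_cast
          ring
        have hne : (p j : ℂ) ≠ 0 := by exact_mod_cast h0.ne'
        rw [e, Complex.cpow_add _ _ hne, Complex.cpow_one, Complex.cpow_def_of_ne_zero hne,
          ← Complex.ofReal_log h0.le]
        have e2 : (Real.log (p j) : ℂ) * -(s.im * Complex.I) =
            ((-m : ℤ) : ℂ) * (2 * Real.pi * Complex.I) := by
          have : ((m * (2 * Real.pi) : ℝ) : ℂ) = ((s.im * Real.log (p j) : ℝ) : ℂ) := by rw [hm]
          push_cast at this ⊢
          linear_combination Complex.I * this
        rw [e2, Complex.exp_int_mul_two_pi_mul_I, mul_one]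
    simp_rw [this]
    rw [← Complex.ofReal_sum, hp.2, Complex.ofReal_one]

/-- The subgroup of `ℝ` generated by the displacements `-log p_j`. -/
def logSubgroup (p : Fin d → ℝ) : AddSubgroup ℝ :=
  AddSubgroup.closure {x | ∃ j, 0 < p j ∧ x = -Real.log (p j)}

lemma neg_log_mem_logSubgroup {j : Fin d} (hj : 0 < p j) : -Real.log (p j) ∈ logSubgroup p :=
  AddSubgroup.subset_closure ⟨j, hj, rfl⟩

lemma exists_int_of_mem_poles (hp : p ∈ stdSimplex ℝ (Fin d)) (hlt : ∀ j, p j < 1) {s : ℂ}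
    (hs : s ∈ poles p) {x : ℝ} (hx : x ∈ logSubgroup p) :
    ∃ m : ℤ, m * (2 * Real.pi) = s.im * x := by
  have hle : logSubgroup p ≤
      (AddSubgroup.zmultiples (2 * Real.pi)).comap (AddMonoidHom.mulLeft s.im) := by
    refine (AddSubgroup.closure_le _).2 ?_
    rintro _ ⟨j, hj, rfl⟩
    obtain ⟨m, hm⟩ := ((mem_poles_iff hp hlt).1 hs).2.2 j hj
    exact ⟨-m, by simp [hm]⟩
  obtain ⟨m, hm⟩ := hle hx
  exact ⟨m, by simpa using hm⟩

lemma isEmpty_poles_of_dense (hp : p ∈ stdSimplex ℝ (Fin d)) (hlt : ∀ j, p j < 1)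
    (hd : Dense (logSubgroup p : Set ℝ)) : IsEmpty (poles p) := by
  refine ⟨fun ⟨s, hs⟩ => ?_⟩
  have him : 0 < |s.im| := abs_pos.2 hs.2.1
  obtain ⟨x, hx, hx0, hx1⟩ := hd.exists_between (div_pos Real.two_pi_pos him)
  obtain ⟨m, hm⟩ := exists_int_of_mem_poles hp hlt hs hx
  have h1 : |(m : ℝ)| * (2 * Real.pi) = |s.im| * x := by
    rw [← abs_of_pos Real.two_pi_pos, ← abs_mul, hm, abs_mul, abs_of_pos hx0]
  rw [lt_div_iff₀ him] at hx1
  have h2 : |(m : ℝ)| < 1 := by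
    by_contra! h
    nlinarith [Real.two_pi_pos]
  have h3 : m = 0 := Int.abs_lt_one_iff.1 (by exact_mod_cast h2)
  rw [h3] at h1
  have : 0 < |s.im| * x := mul_pos him hx0
  simp at h1
  linarith [h1.resolve_left (abs_pos.1 him)]

lemma isPeriodic_of_mem_poles (hp : p ∈ stdSimplex ℝ (Fin d)) (hlt : ∀ j, p j < 1) {s : ℂ}
    (hs : s ∈ poles p) : IsPeriodic p := by
  obtain ⟨-, him, hall⟩ := (mem_poles_iff hp hlt).1 hs
  have hex : ∀ j, ∃ k : ℕ, 0 < k ∧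
      (0 < p j → p j ^ (1 / (k : ℝ)) = Real.exp (-(2 * Real.pi / |s.im|))) := by
    intro j
    by_cases hj : 0 < p j
    · obtain ⟨m, hm⟩ := hall j hj
      have hlog : Real.log (p j) < 0 := Real.log_neg hj (hlt j)
      have hm0 : m ≠ 0 := by
        rintro rfl
        rw [Int.cast_zero, zero_mul, eq_comm, mul_eq_zero] at hm
        exact hm.elim him hlog.ne
      refine ⟨m.natAbs, Int.natAbs_pos.2 hm0, fun _ => ?_⟩
      have h1 : |(m : ℝ)| * (2 * Real.pi) = |s.im| * -Real.log (p j) := by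
        rw [← abs_of_pos Real.two_pi_pos, ← abs_mul, hm, abs_mul, abs_of_neg hlog]
      have him' : |s.im| ≠ 0 := abs_ne_zero.2 him
      have hm' : |(m : ℝ)| ≠ 0 := abs_ne_zero.2 (by exact_mod_cast hm0)
      rw [Real.rpow_def_of_pos hj, Nat.cast_natAbs, Int.cast_abs]
      congr 1
      field_simp
      linarith
    · exact ⟨1, one_pos, fun h => absurd h hj⟩
  choose k hk0 hk using hex
  exact ⟨k, hk0, fun i j hi hj => (hk i hi).trans (hk j hj).symm⟩

/-- The pole on the line `Re s = -1` that belongs to the `m`-th frequency of a lattice of span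
`h`. -/
noncomputable def latticePole (h : ℝ) (m : ℤ) : ℂ := -1 + (2 * Real.pi * m / h : ℝ) * Complex.I

lemma latticePole_mem_poles (hp : p ∈ stdSimplex ℝ (Fin d)) (hlt : ∀ j, p j < 1) {h : ℝ}
    (hh : 0 < h) (hspan : logSubgroup p = AddSubgroup.closure {h}) {m : ℤ} (hm : m ≠ 0) :
    latticePole h m ∈ poles p := by
  have hm' : (m : ℝ) ≠ 0 := by exact_mod_cast hm
  refine (mem_poles_iff hp hlt).2 ⟨by simp [latticePole], ?_, fun j hj => ?_⟩
  · simp [latticePole, hh.ne', hm, Real.pi_ne_zero]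
  · obtain ⟨k, hk⟩ := AddSubgroup.mem_closure_singleton.1 (hspan ▸ neg_log_mem_logSubgroup hj)
    refine ⟨-(m * k), ?_⟩
    rw [zsmul_eq_mul] at hk
    rw [← neg_neg (Real.log (p j)), ← hk]
    simp only [latticePole, Complex.add_im, Complex.neg_im, Complex.one_im, Complex.mul_I_im,
      Complex.ofReal_re]
    push_cast
    field_simp
    ring

/-- In the lattice case the poles are indexed by the nonzero integers. -/
noncomputable def polesEquiv (hp : p ∈ stdSimplex ℝ (Fin d)) (hlt : ∀ j, p j < 1) {h : ℝ}
    (hh : 0 < h) (hspan : logSubgroup p = AddSubgroup.closure {h}) :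
    ({0}ᶜ : Set ℤ) ≃ poles p :=
  Equiv.ofBijective (fun m => ⟨latticePole h m, latticePole_mem_poles hp hlt hh hspan m.2⟩) <| by
    constructor
    · rintro ⟨m, hm⟩ ⟨m', hm'⟩ heq
      have h1 := congrArg Complex.im (congrArg Subtype.val heq)
      simp only [latticePole, Complex.add_im, Complex.neg_im, Complex.one_im, Complex.mul_I_im,
        Complex.ofReal_re] at h1
      have hpi := Real.pi_ne_zero
      field_simp at h1
      norm_cast at h1
      exact Subtype.ext (by simpa using h1)
    · rintro ⟨s, hs⟩
      have hmem : h ∈ logSubgroup p := hspan ▸ AddSubgroup.subset_closure rfl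
      obtain ⟨m, hm⟩ := exists_int_of_mem_poles hp hlt hs hmem
      obtain ⟨hre, him, -⟩ := (mem_poles_iff hp hlt).1 hs
      refine ⟨⟨m, ?_⟩, Subtype.ext (Complex.ext ?_ ?_)⟩
      · rintro rfl
        rw [Int.cast_zero, zero_mul, eq_comm, mul_eq_zero] at hm
        exact hm.elim him hh.ne'
      · simp [latticePole, hre]
      · simp only [latticePole, Complex.add_im, Complex.neg_im, Complex.one_im, Complex.mul_I_im,
          Complex.ofReal_re]
        field_simp
        linarith

/-- The entropy of the splitting law. -/
noncomputable def entropy (p : Fin d → ℝ) : ℝ := -∑ j, p j * Real.log (p j)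

lemma entropy_pos (hp : p ∈ stdSimplex ℝ (Fin d)) (hlt : ∀ j, p j < 1) : 0 < entropy p := by
  rw [entropy, ← Finset.sum_neg_distrib]
  obtain ⟨j, hj⟩ := exists_pos_of_mem_stdSimplex hp
  refine Finset.sum_pos' (fun i _ => ?_) ⟨j, Finset.mem_univ j, ?_⟩
  · have := Real.log_nonpos (hp.1 i) (hlt i).le
    nlinarith [hp.1 i]
  · have := Real.log_neg hj (hlt j)
    nlinarith

lemma fluctTerm_latticePole {h : ℝ} (hh : 0 < h) {m : ℤ} (hm : m ≠ 0) {n : ℕ} (hn : 1 ≤ n) {α : ℝ}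
    (hα : 0 < α) :
    fluctTerm p n α (latticePole h m) = (α / entropy p : ℝ) *
      (rateCoeff h m *
        Complex.exp (-((2 * Real.pi * m / h * Real.log (n * α) : ℝ) * Complex.I))) := by
  have hn0 : (0 : ℝ) < n := by exact_mod_cast hn
  have hm' : (m : ℝ) ≠ 0 := by exact_mod_cast hm
  set τ : ℝ := 2 * Real.pi * m / h with hτ
  have hτ0 : τ ≠ 0 := by
    have := Real.pi_ne_zero
    positivity
  set s : ℂ := latticePole h m with hs
  have hs' : s = -1 + τ * Complex.I := rfl
  have hs1 : s + 1 ≠ 0 := by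
    rw [hs', neg_add_cancel_comm]
    exact mul_ne_zero (by exact_mod_cast hτ0) Complex.I_ne_zero
  have hs0 : s ≠ 0 := by
    intro h0
    have := congrArg Complex.re h0
    simp [hs'] at this
  have hG : (s + 1) * Complex.Gamma s = -rateCoeff h m := by
    rw [rateCoeff_eq, neg_neg, ← hτ, ← hs', eq_div_iff hs0,
      show (1 : ℂ) + τ * Complex.I = s + 1 + 1 by rw [hs']; ring, Complex.Gamma_add_one _ hs1,
      Complex.Gamma_add_one _ hs0]
    ring
  have hα0 : (α : ℂ) ≠ 0 := by exact_mod_cast hα.ne'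
  have hnc : (n : ℂ) ≠ 0 := by exact_mod_cast hn0.ne'
  have e1 : -s = 1 + -(τ * Complex.I) := by rw [hs']; ring
  have e2 : -s - 1 = -(τ * Complex.I) := by rw [hs']; ring
  have e3 : Complex.log (n : ℂ) = Real.log n := by
    rw [Complex.ofReal_log hn0.le, Complex.ofReal_natCast]
  rw [fluctTerm, hG, e2, e1, Complex.cpow_add _ _ hα0, Complex.cpow_one,
    Complex.cpow_def_of_ne_zero hα0, Complex.cpow_def_of_ne_zero hnc, e3,
    ← Complex.ofReal_log hα.le, mul_assoc, mul_assoc, ← mul_assoc (Complex.exp _),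
    ← Complex.exp_add, Real.log_mul hn0.ne' hα.ne']
  rw [show (Real.log α : ℂ) * -(τ * Complex.I) + Real.log n * -(τ * Complex.I) =
    -(((τ * (Real.log n + Real.log α) : ℝ) : ℂ) * Complex.I) by push_cast; ring, entropy]
  rw [div_neg, Complex.ofReal_neg, Complex.ofReal_div]
  ring

lemma hasSum_fluctTerm_lattice (hp : p ∈ stdSimplex ℝ (Fin d)) (hlt : ∀ j, p j < 1) {h : ℝ}
    (hh : 0 < h) (hspan : logSubgroup p = AddSubgroup.closure {h}) {n : ℕ} (hn : 1 ≤ n) {α : ℝ}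
    (hα : 0 < α) :
    HasSum (fun s : poles p => fluctTerm p n α s)
      ((α / entropy p *
        (h * ∑' i : ℤ, collisionRate (Real.log (n * α) - i * h) - 1) : ℝ) : ℂ) := by
  set c : ℤ → ℂ := fun m => rateCoeff h m *
        Complex.exp (-((2 * Real.pi * m / h * Real.log (n * α) : ℝ) * Complex.I)) with hc
  have hcs : Summable c := by
    refine .of_norm ((summable_norm_rateCoeff hh).congr fun m => ?_)
    rw [hc, norm_mul, ← neg_mul, ← Complex.ofReal_neg, Complex.norm_exp_ofReal_mul_I, mul_one]
  have hc0 : c 0 = 1 := by simp [hc, rateCoeff_zero]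
  rw [← (polesEquiv hp hlt hh hspan).hasSum_iff]
  have h1 : HasSum (fun m : ({0}ᶜ : Set ℤ) => c m)
      (((h * ∑' i : ℤ, collisionRate (Real.log (n * α) - i * h) : ℝ) : ℂ) - 1) := by
    rw [tsum_collisionRate_eq hh]
    have := hcs.tsum_subtype_add_tsum_subtype_compl {0}
    rw [tsum_singleton (f := c) 0, hc0] at this
    rw [← this, add_sub_cancel_left]
    exact (hcs.subtype _).hasSum
  have h2 := h1.mul_left ((α / entropy p : ℝ) : ℂ)
  rw [Complex.ofReal_mul (α / entropy p), Complex.ofReal_sub, Complex.ofReal_one]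
  refine h2.congr_fun fun m => ?_
  exact fluctTerm_latticePole hh m.2 hn hα

end Poles

/-! ### Asymptotics of the sum over the tree -/

section Asymptotics

variable {d : ℕ} {p : Fin d → ℝ}

/-- The sum of the Poisson collision probabilities over the tree per user, as a function of the
logarithm of the mean number of users. -/
noncomputable def treeRate (p : Fin d → ℝ) (u : ℝ) : ℝ :=
  treeSum p poissonCollision (Real.exp u) * Real.exp (-u)

lemma treeSum_poissonCollision_zero (hp : p ∈ stdSimplex ℝ (Fin d)) (hlt : ∀ j, p j < 1) :
    treeSum p poissonCollision 0 = 0 := by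
  have := abs_treeSum_le hp hlt (by norm_num) (fun y hy => abs_poissonCollision_le hy) le_rfl
  simpa using this

/-- The displacement of a branch of probability zero is, by the convention `log 0 = 0`, also zero;
its weight is zero as well. -/
lemma treeRate_eq (hp : p ∈ stdSimplex ℝ (Fin d)) (hlt : ∀ j, p j < 1) (u : ℝ) :
    treeRate p u = collisionRate u + ∑ j, p j * treeRate p (u - -Real.log (p j)) := by
  rw [treeRate, treeSum_eq_add_sum hp hlt (Real.exp_pos u).le
    (fun y hy _ => abs_poissonCollision_le_sq hy), add_mul, Finset.sum_mul]
  congr 1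
  refine Finset.sum_congr rfl fun j _ => ?_
  rcases (hp.1 j).eq_or_lt with h0 | h0
  · rw [← h0]; simp [treeSum_poissonCollision_zero hp hlt]
  · rw [treeRate, sub_neg_eq_add, Real.exp_add, Real.exp_log h0, mul_comm (Real.exp u), neg_add,
      Real.exp_add, Real.exp_neg (Real.log _), Real.exp_log h0]
    field_simp

lemma abs_treeRate_le (hp : p ∈ stdSimplex ℝ (Fin d)) (hlt : ∀ j, p j < 1) (u : ℝ) :
    |treeRate p u| ≤ 4 / (1 - ∑ j, p j ^ 2) * min 1 (Real.exp u) := by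
  have hρ1 : 0 < 1 - ∑ j, p j ^ 2 := sub_pos.2 (sum_pow_lt_one hp hlt le_rfl)
  have hu := Real.exp_pos u
  rw [treeRate, abs_mul, abs_of_pos (Real.exp_pos (-u)), Real.exp_neg]
  calc _ ≤ 4 / (1 - ∑ j, p j ^ 2) * (Real.exp u ^ 2 / (1 + Real.exp u)) * (Real.exp u)⁻¹ := by
        gcongr
        exact abs_treeSum_le hp hlt (by norm_num) (fun y hy => abs_poissonCollision_le hy) hu.le
    _ = 4 / (1 - ∑ j, p j ^ 2) * (Real.exp u / (1 + Real.exp u)) := by field_simp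
    _ ≤ _ := by
        gcongr
        refine le_min ?_ ?_
        · rw [div_le_one (by positivity)]; linarith
        · exact div_le_self hu.le (by linarith)

lemma tendsto_treeRate_atBot (hp : p ∈ stdSimplex ℝ (Fin d)) (hlt : ∀ j, p j < 1) :
    Tendsto (treeRate p) atBot (𝓝 0) := by
  have hl : Tendsto (fun u => 4 / (1 - ∑ j, p j ^ 2) * Real.exp u) atBot (𝓝 0) := by
    simpa using Real.tendsto_exp_atBot.const_mul (4 / (1 - ∑ j, p j ^ 2))
  refine squeeze_zero_norm (fun u => (abs_treeRate_le hp hlt u).trans ?_) hl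
  have hρ1 : 0 < 1 - ∑ j, p j ^ 2 := sub_pos.2 (sum_pow_lt_one hp hlt le_rfl)
  gcongr
  exact min_le_right _ _

/-- The increments of `poissonCollision y / y` over a small logarithmic step are small, uniformly
with respect to the weight that makes sums over the tree converge. -/
lemma abs_poissonCollision_mul_sub_le {r y : ℝ} (hr : 1 ≤ r) (hr2 : r ≤ 2) (hy : 0 ≤ y) :
    |r⁻¹ * poissonCollision (r * y) - poissonCollision y| ≤ 8 * (r - 1) * (y / (1 + y)) ^ 2 := by
  set t := (r - 1) * y with ht
  have hr1 : 0 ≤ r - 1 := sub_nonneg.2 hr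
  have ht0 : 0 ≤ t := mul_nonneg hr1 hy
  have hdiff : poissonCollision (r * y) - poissonCollision y =
      Real.exp (-y) * (1 + y - Real.exp (-t) * (1 + y + t)) := by
    have : Real.exp (-(r * y)) = Real.exp (-y) * Real.exp (-t) := by
      rw [← Real.exp_add, ht]; ring_nf
    rw [poissonCollision, poissonCollision, this, ht]; ring
  have hup : poissonCollision (r * y) - poissonCollision y ≤
      Real.exp (-y) * (2 * (r - 1) * y ^ 2) := by
    rw [hdiff]
    gcongr
    have h1 := mul_le_mul_of_nonneg_right (Real.add_one_le_exp (-t))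
      (by positivity : 0 ≤ 1 + y + t)
    have h2 : t * (y + t) ≤ 2 * (r - 1) * y ^ 2 := by
      have : t * (y + t) = (r - 1) * y ^ 2 * r := by rw [ht]; ring
      rw [this]
      have : 0 ≤ (r - 1) * y ^ 2 := by positivity
      nlinarith
    nlinarith
  have hlow : 0 ≤ poissonCollision (r * y) - poissonCollision y := by
    rw [hdiff]
    refine mul_nonneg (Real.exp_pos _).le (sub_nonneg.2 ?_)
    have h1 : 1 + y + t ≤ (1 + y) * Real.exp t := by
      have := mul_le_mul_of_nonneg_left (Real.add_one_le_exp t) (by positivity : 0 ≤ 1 + y)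
      nlinarith
    calc _ ≤ Real.exp (-t) * ((1 + y) * Real.exp t) := by gcongr
      _ = 1 + y := by rw [mul_left_comm, ← Real.exp_add]; simp
  have hexp : Real.exp (-y) * y ^ 2 ≤ 2 * (y / (1 + y)) ^ 2 := by
    have h1 := Real.quadratic_le_exp_of_nonneg hy
    have h2 : (1 + y) ^ 2 / 2 ≤ Real.exp y := by nlinarith
    rw [Real.exp_neg, div_pow, mul_comm, mul_div_assoc', ← div_eq_mul_inv,
      div_le_div_iff₀ (Real.exp_pos y) (by positivity)]
    nlinarith [sq_nonneg y]
  have hpsi := abs_poissonCollision_le hy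
  rw [abs_of_nonneg (poissonCollision_nonneg y)] at hpsi
  have hri : r⁻¹ ≤ 1 := inv_le_one_of_one_le₀ hr
  have hri0 : 0 ≤ r⁻¹ := by positivity
  have hri2 : 1 - r⁻¹ ≤ r - 1 := by
    have h0 : 0 < r := by linarith
    have : r * r⁻¹ = 1 := mul_inv_cancel₀ h0.ne'
    nlinarith
  have e : r⁻¹ * poissonCollision (r * y) - poissonCollision y =
      r⁻¹ * (poissonCollision (r * y) - poissonCollision y) - (1 - r⁻¹) * poissonCollision y := by
    ring
  have hA : r⁻¹ * (poissonCollision (r * y) - poissonCollision y) ≤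
      (r - 1) * (4 * (y / (1 + y)) ^ 2) := by
    calc _ ≤ 1 * (Real.exp (-y) * (2 * (r - 1) * y ^ 2)) := by gcongr
      _ = (r - 1) * (2 * (Real.exp (-y) * y ^ 2)) := by ring
      _ ≤ (r - 1) * (2 * (2 * (y / (1 + y)) ^ 2)) := by gcongr
      _ = _ := by ring
  have hB : (1 - r⁻¹) * poissonCollision y ≤ (r - 1) * (4 * (y / (1 + y)) ^ 2) := by
    have := poissonCollision_nonneg y
    gcongr
  have hA0 : 0 ≤ r⁻¹ * (poissonCollision (r * y) - poissonCollision y) := mul_nonneg hri0 hlow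
  have hB0 : 0 ≤ (1 - r⁻¹) * poissonCollision y :=
    mul_nonneg (by linarith) (poissonCollision_nonneg y)
  rw [e, abs_le]
  constructor <;> nlinarith

lemma abs_treeRate_add_sub_le (hp : p ∈ stdSimplex ℝ (Fin d)) (hlt : ∀ j, p j < 1) (u : ℝ) {t : ℝ}
    (ht : 0 ≤ t) (ht2 : Real.exp t ≤ 2) :
    |treeRate p (u + t) - treeRate p u| ≤ 8 / (1 - ∑ j, p j ^ 2) * (Real.exp t - 1) := by
  have hρ1 : 0 < 1 - ∑ j, p j ^ 2 := sub_pos.2 (sum_pow_lt_one hp hlt le_rfl)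
  set r := Real.exp t with hr
  set y := Real.exp u with hy
  have hy0 : 0 < y := Real.exp_pos u
  have hr1 : 1 ≤ r := Real.one_le_exp ht
  have h1 : treeRate p (u + t) - treeRate p u =
      treeSum p (fun z => r⁻¹ * poissonCollision (r * z) - poissonCollision z) y * y⁻¹ := by
    have hs1 : Summable fun m => (splitSum p)^[m] (fun z => r⁻¹ * poissonCollision (r * z)) y := by
      simp_rw [splitSum_iterate_const_mul, splitSum_iterate_comp_mul]
      exact (summable_splitSum_iterate hp hlt (by positivity)
        (fun y hy _ => abs_poissonCollision_le_sq hy)).mul_left _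
    have hs2 : Summable fun m => (splitSum p)^[m] poissonCollision y :=
      summable_splitSum_iterate hp hlt hy0.le (fun y hy _ => abs_poissonCollision_le_sq hy)
    rw [treeSum]
    simp_rw [splitSum_iterate_sub]
    rw [hs1.tsum_sub hs2]
    simp_rw [splitSum_iterate_const_mul, splitSum_iterate_comp_mul]
    rw [tsum_mul_left, treeRate, treeRate, treeSum, treeSum, ← hy, Real.exp_neg, Real.exp_neg,
      Real.exp_add, ← hr, ← hy, mul_inv, mul_comm y r]
    ring
  rw [h1, abs_mul, abs_of_pos (inv_pos.2 hy0)]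
  have hr0 : 0 ≤ r - 1 := sub_nonneg.2 hr1
  calc _ ≤ 8 * (r - 1) / (1 - ∑ j, p j ^ 2) * (y ^ 2 / (1 + y)) * y⁻¹ := by
        gcongr
        exact abs_treeSum_le hp hlt (by positivity)
          (fun z hz => abs_poissonCollision_mul_sub_le hr1 ht2 hz) hy0.le
    _ = 8 / (1 - ∑ j, p j ^ 2) * (r - 1) * (y / (1 + y)) := by field_simp
    _ ≤ 8 / (1 - ∑ j, p j ^ 2) * (r - 1) * 1 := by
        gcongr
        rw [div_le_one (by positivity)]; linarith
    _ = _ := mul_one _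

lemma uniformContinuous_treeRate (hp : p ∈ stdSimplex ℝ (Fin d)) (hlt : ∀ j, p j < 1) :
    UniformContinuous (treeRate p) := by
  have hρ1 : 0 < 1 - ∑ j, p j ^ 2 := sub_pos.2 (sum_pow_lt_one hp hlt le_rfl)
  set K := 8 / (1 - ∑ j, p j ^ 2) with hK
  have hK0 : 0 < K := by positivity
  rw [Metric.uniformContinuous_iff]
  intro ε hε
  obtain ⟨δ, hδ, h⟩ := Metric.continuousAt_iff.1 (Real.continuous_exp.continuousAt (x := 0))
    (min 1 (ε / K)) (by positivity)
  have key : ∀ u t : ℝ, 0 ≤ t → t < δ → |treeRate p (u + t) - treeRate p u| < ε := by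
    intro u t ht htδ
    have h1 := h (x := t) (by rwa [Real.dist_eq, sub_zero, abs_of_nonneg ht])
    rw [Real.dist_eq, Real.exp_zero, abs_of_nonneg (sub_nonneg.2 (Real.one_le_exp ht)),
      lt_min_iff, lt_div_iff₀ hK0] at h1
    refine (abs_treeRate_add_sub_le hp hlt u ht (by linarith)).trans_lt ?_
    rw [mul_comm]; exact h1.2
  refine ⟨δ, hδ, fun {a b} hab => ?_⟩
  rw [Real.dist_eq] at hab ⊢
  rcases le_total a b with hle | hle
  · rw [abs_sub_comm] at hab ⊢
    rw [abs_of_nonneg (sub_nonneg.2 hle)] at hab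
    simpa using key a (b - a) (sub_nonneg.2 hle) hab
  · rw [abs_of_nonneg (sub_nonneg.2 hle)] at hab
    simpa using key b (a - b) (sub_nonneg.2 hle) hab

lemma tendsto_collisionRate_atTop : Tendsto collisionRate atTop (𝓝 0) :=
  squeeze_zero collisionRate_nonneg collisionRate_le_exp_neg
    (Real.tendsto_exp_neg_atTop_nhds_zero)

lemma logSubgroup_le_asymptoticPeriods (hp : p ∈ stdSimplex ℝ (Fin d)) (hlt : ∀ j, p j < 1) :
    logSubgroup p ≤ asymptoticPeriods (treeRate p) := by
  refine (AddSubgroup.closure_le _).2 ?_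
  rintro _ ⟨j, hj, rfl⟩
  have hρ1 : 0 < 1 - ∑ j, p j ^ 2 := sub_pos.2 (sum_pow_lt_one hp hlt le_rfl)
  refine mem_asymptoticPeriods_of_renewal (a := fun j => -Real.log (p j))
    (B := 4 / (1 - ∑ j, p j ^ 2)) hp (treeRate_eq hp hlt) tendsto_collisionRate_atTop
    (fun x => (abs_treeRate_le hp hlt x).trans ?_) hj
  exact mul_le_of_le_one_right (by positivity) (min_le_left _ _)

/-- The integral of `collisionRate` over `(-∞, u]`. -/
noncomputable def collisionRateIntegral (u : ℝ) : ℝ :=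
  1 - (1 - Real.exp (-Real.exp u)) * Real.exp (-u)

lemma hasDerivAt_collisionRateIntegral (u : ℝ) :
    HasDerivAt collisionRateIntegral (collisionRate u) u := by
  have h1 : HasDerivAt (fun u => Real.exp (-Real.exp u))
      (Real.exp (-Real.exp u) * -Real.exp u) u := (Real.hasDerivAt_exp u).neg.exp
  have h2 : HasDerivAt (fun u => Real.exp (-u)) (Real.exp (-u) * -1) u := (hasDerivAt_neg u).exp
  have h3 := ((h1.const_sub 1).mul h2).const_sub 1
  convert! h3 using 1
  rw [collisionRate, poissonCollision]
  ring

lemma tendsto_collisionRateIntegral_atTop : Tendsto collisionRateIntegral atTop (𝓝 1) := by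
  have h : Tendsto (fun u => (1 - Real.exp (-Real.exp u)) * Real.exp (-u)) atTop
      (𝓝 ((1 - 0) * 0)) := by
    refine Tendsto.mul (Tendsto.const_sub _ ?_) Real.tendsto_exp_neg_atTop_nhds_zero
    exact Real.tendsto_exp_neg_atTop_nhds_zero.comp Real.tendsto_exp_atTop
  unfold collisionRateIntegral
  simpa using h.const_sub 1

lemma tendsto_collisionRateIntegral_atBot : Tendsto collisionRateIntegral atBot (𝓝 0) := by
  refine squeeze_zero_norm' ?_ Real.tendsto_exp_atBot
  filter_upwards [eventually_le_atBot 0] with u hu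
  have hy := Real.exp_pos u
  have hy1 : Real.exp u ≤ 1 := Real.exp_le_one_iff.2 hu
  have h1 := Real.abs_exp_sub_one_sub_id_le (x := -Real.exp u) (by rwa [abs_neg, abs_of_pos hy])
  have e : collisionRateIntegral u =
      (Real.exp (-Real.exp u) - 1 - -Real.exp u) * Real.exp (-u) := by
    have : Real.exp u * Real.exp (-u) = 1 := by rw [← Real.exp_add]; simp
    rw [collisionRateIntegral]
    linear_combination -this
  rw [Real.norm_eq_abs, e, abs_mul, abs_of_pos (Real.exp_pos (-u))]
  calc _ ≤ (-Real.exp u) ^ 2 * Real.exp (-u) := by gcongr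
    _ = Real.exp u := by rw [neg_sq, sq, mul_assoc, ← Real.exp_add]; simp

lemma sum_mul_neg_log : ∑ j, p j * -Real.log (p j) = entropy p := by
  simp_rw [mul_neg, entropy, Finset.sum_neg_distrib]

lemma tendsto_treeRate_of_dense (hp : p ∈ stdSimplex ℝ (Fin d)) (hlt : ∀ j, p j < 1)
    (hd : Dense (logSubgroup p : Set ℝ)) :
    Tendsto (fun u => entropy p * treeRate p u) atTop (𝓝 1) := by
  have hρ1 : 0 < 1 - ∑ j, p j ^ 2 := sub_pos.2 (sum_pow_lt_one hp hlt le_rfl)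
  rw [← sum_mul_neg_log]
  refine tendsto_renewal_of_forall_mem (B := 4 / (1 - ∑ j, p j ^ 2)) hp (treeRate_eq hp hlt)
    (uniformContinuous_treeRate hp hlt).continuous (tendsto_treeRate_atBot hp hlt)
    hasDerivAt_collisionRateIntegral tendsto_collisionRateIntegral_atBot
    tendsto_collisionRateIntegral_atTop (fun x => (abs_treeRate_le hp hlt x).trans ?_) fun v => ?_
  · exact mul_le_of_le_one_right (by positivity) (min_le_left _ _)
  · have hcl := isClosed_asymptoticPeriods (uniformContinuous_treeRate hp hlt)
    have hd' := hd.mono (logSubgroup_le_asymptoticPeriods hp hlt)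
    have : v ∈ closure (asymptoticPeriods (treeRate p) : Set ℝ) := hd' v
    rwa [hcl.closure_eq] at this

lemma exp_neg_nat_mul (h : ℝ) (i : ℕ) : Real.exp (-(i * h)) = Real.exp (-h) ^ i := by
  rw [← Real.exp_nat_mul]; ring_nf

lemma summable_collisionRate_lattice {h : ℝ} (hh : 0 < h) (x : ℝ) :
    Summable fun i : ℤ => collisionRate (x - i * h) := by
  have hg : Summable fun i : ℕ => Real.exp (-h) ^ i :=
    summable_geometric_of_lt_one (Real.exp_pos _).le (Real.exp_lt_one_iff.2 (by linarith))
  refine .of_nat_of_neg (.of_nonneg_of_le (fun _ => collisionRate_nonneg _) (fun i => ?_)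
    (hg.mul_left (Real.exp x))) (.of_nonneg_of_le (fun _ => collisionRate_nonneg _) (fun i => ?_)
    (hg.mul_left (Real.exp (-x))))
  · refine (collisionRate_le_exp _).trans_eq ?_
    rw [← exp_neg_nat_mul, ← Real.exp_add]; simp [sub_eq_add_neg]
  · refine (collisionRate_le_exp_neg _).trans_eq ?_
    rw [← exp_neg_nat_mul, ← Real.exp_add]; congr 1; push_cast; ring

lemma tendsto_tsum_collisionRate_add {h : ℝ} (hh : 0 < h) :
    Tendsto (fun x => ∑' i : ℕ, collisionRate (x + (i + 1) * h)) atTop (𝓝 0) := by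
  have hg : Summable fun i : ℕ => Real.exp (-h) ^ i :=
    summable_geometric_of_lt_one (Real.exp_pos _).le (Real.exp_lt_one_iff.2 (by linarith))
  have hl : Tendsto (fun x => Real.exp (-x) * ∑' i : ℕ, Real.exp (-h) ^ i) atTop (𝓝 0) := by
    simpa using Real.tendsto_exp_neg_atTop_nhds_zero.mul_const (∑' i : ℕ, Real.exp (-h) ^ i)
  refine squeeze_zero (fun x => tsum_nonneg fun i => collisionRate_nonneg _) (fun x => ?_) hl
  rw [← tsum_mul_left]
  have hb : ∀ i : ℕ, collisionRate (x + (i + 1) * h) ≤ Real.exp (-x) * Real.exp (-h) ^ i := by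
    intro i
    refine (collisionRate_le_exp_neg _).trans ?_
    rw [← exp_neg_nat_mul, ← Real.exp_add, Real.exp_le_exp]
    nlinarith
  exact Summable.tsum_le_tsum hb (.of_nonneg_of_le (fun _ => collisionRate_nonneg _) hb
    (hg.mul_left _)) (hg.mul_left _)

lemma tsum_collisionRate_int {h : ℝ} (hh : 0 < h) (x : ℝ) :
    ∑' i : ℤ, collisionRate (x - i * h) =
      ∑' i : ℕ, collisionRate (x - i * h) + ∑' i : ℕ, collisionRate (x + (i + 1) * h) := by
  have hs := summable_collisionRate_lattice hh x
  have hs' : Summable fun i : ℕ => collisionRate (x - ((i : ℤ) : ℝ) * h) :=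
    hs.comp_injective Nat.cast_injective
  have hs'' : Summable fun i : ℕ => collisionRate (x - ((-((i : ℤ) + 1) : ℤ) : ℝ) * h) :=
    hs.comp_injective (i := fun n : ℕ => -((n : ℤ) + 1)) fun a b hab => by simpa using hab
  rw [tsum_of_nat_of_neg_add_one (f := fun i : ℤ => collisionRate (x - i * h)) hs' hs'']
  congr 1
  refine tsum_congr fun i => ?_
  congr 1
  push_cast; ring

lemma tendsto_treeRate_of_lattice (hp : p ∈ stdSimplex ℝ (Fin d)) (hlt : ∀ j, p j < 1) {h : ℝ}
    (hh : 0 < h) (hspan : logSubgroup p = AddSubgroup.closure {h}) :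
    Tendsto (fun u => entropy p * treeRate p u - h * ∑' i : ℤ, collisionRate (u - i * h)) atTop
      (𝓝 0) := by
  have hex : ∀ j, ∃ k : ℕ, -Real.log (p j) = k * h := by
    intro j
    rcases (hp.1 j).eq_or_lt with h0 | h0
    · exact ⟨0, by rw [← h0]; simp⟩
    · obtain ⟨k, hk⟩ := AddSubgroup.mem_closure_singleton.1 (hspan ▸ neg_log_mem_logSubgroup h0)
      rw [zsmul_eq_mul] at hk
      have hlog := Real.log_neg h0 (hlt j)
      have hk0 : 0 ≤ k := by
        by_contra! hneg
        have : (k : ℝ) < 0 := by exact_mod_cast hneg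
        nlinarith
      lift k to ℕ using hk0
      exact ⟨k, by rw [← hk]; simp⟩
  choose k hk using hex
  have hmem : h ∈ asymptoticPeriods (treeRate p) :=
    logSubgroup_le_asymptoticPeriods hp hlt (hspan ▸ AddSubgroup.subset_closure rfl)
  have h1 := tendsto_renewal_of_lattice hp hh (k := k) collisionRate_nonneg
    (fun x => by simp_rw [← hk]; exact treeRate_eq hp hlt x) (tendsto_treeRate_atBot hp hlt) hmem
  have hent : entropy p = h * ∑ i, p i * k i := by
    rw [← sum_mul_neg_log, Finset.mul_sum]
    exact Finset.sum_congr rfl fun i _ => by rw [hk]; ring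
  have h2 := (h1.sub (tendsto_tsum_collisionRate_add hh)).const_mul h
  rw [sub_zero, mul_zero] at h2
  refine h2.congr fun u => ?_
  rw [hent, tsum_collisionRate_int hh]
  ring

/-- The displacements generate a dense subgroup or a lattice. -/
lemma dense_or_lattice (hp : p ∈ stdSimplex ℝ (Fin d)) (hlt : ∀ j, p j < 1) :
    Dense (logSubgroup p : Set ℝ) ∨
      ∃ h : ℝ, 0 < h ∧ logSubgroup p = AddSubgroup.closure {h} := by
  refine (logSubgroup p).dense_or_cyclic.imp_right fun ⟨a, ha⟩ => ⟨|a|, abs_pos.2 ?_, ?_⟩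
  · rintro rfl
    obtain ⟨j, hj⟩ := exists_pos_of_mem_stdSimplex hp
    obtain ⟨k, hk⟩ := AddSubgroup.mem_closure_singleton.1 (ha ▸ neg_log_mem_logSubgroup hj)
    have := Real.log_neg hj (hlt j)
    rw [smul_zero] at hk
    linarith
  · rw [ha]
    rcases abs_choice a with h | h <;> rw [h]
    rw [← Set.neg_singleton, AddSubgroup.closure_neg]

lemma fluctTerm_zero (n : ℕ) (s : poles p) : fluctTerm p n 0 s = 0 := by
  simp [fluctTerm, ne_zero_of_mem_poles s.2]

lemma summable_fluctTerm (hp : p ∈ stdSimplex ℝ (Fin d)) (hlt : ∀ j, p j < 1) {n : ℕ} (hn : 1 ≤ n)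
    {α : ℝ} (hα : 0 ≤ α) : Summable fun s : poles p => fluctTerm p n α s := by
  rcases hα.eq_or_lt with rfl | hα
  · simp_rw [fluctTerm_zero]; exact summable_zero
  rcases dense_or_lattice hp hlt with hd | ⟨h, hh, hspan⟩
  · have := isEmpty_poles_of_dense hp hlt hd
    exact (hasSum_empty).summable
  · exact (hasSum_fluctTerm_lattice hp hlt hh hspan hn hα).summable

lemma im_tsum_fluctTerm (hp : p ∈ stdSimplex ℝ (Fin d)) (hlt : ∀ j, p j < 1) {n : ℕ} (hn : 1 ≤ n)
    {α : ℝ} (hα : 0 ≤ α) : (∑' s : poles p, fluctTerm p n α s).im = 0 := by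
  rcases hα.eq_or_lt with rfl | hα
  · simp_rw [fluctTerm_zero, tsum_zero, Complex.zero_im]
  rcases dense_or_lattice hp hlt with hd | ⟨h, hh, hspan⟩
  · have := isEmpty_poles_of_dense hp hlt hd
    rw [tsum_empty, Complex.zero_im]
  · rw [(hasSum_fluctTerm_lattice hp hlt hh hspan hn hα).tsum_eq, Complex.ofReal_im]

lemma tendsto_treeSum_poissonCollision (hp : p ∈ stdSimplex ℝ (Fin d)) (hlt : ∀ j, p j < 1)
    {α : ℝ} (hα : 0 ≤ α) :
    Tendsto (fun n : ℕ => treeSum p poissonCollision (n * α) / n -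
      (α / entropy p + (∑' s : poles p, fluctTerm p n α s).re)) atTop (𝓝 0) := by
  rcases hα.eq_or_lt with rfl | hα
  · simp_rw [fluctTerm_zero, tsum_zero, mul_zero, treeSum_poissonCollision_zero hp hlt]
    simp
  have hH := (entropy_pos hp hlt).ne'
  have hlog : Tendsto (fun n : ℕ => Real.log (n * α)) atTop atTop :=
    Real.tendsto_log_atTop.comp (tendsto_natCast_atTop_atTop.atTop_mul_const hα)
  have hrate : ∀ n : ℕ, 1 ≤ n →
      treeSum p poissonCollision (n * α) / n = α * treeRate p (Real.log (n * α)) := by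
    intro n hn
    have hn0 : (0 : ℝ) < n := by exact_mod_cast hn
    rw [treeRate, Real.exp_neg, Real.exp_log (by positivity)]
    field_simp
  rcases dense_or_lattice hp hlt with hd | ⟨h, hh, hspan⟩
  · have := isEmpty_poles_of_dense hp hlt hd
    have h1 := (((tendsto_treeRate_of_dense hp hlt hd).sub_const 1).comp hlog).const_mul
      (α / entropy p)
    rw [sub_self, mul_zero] at h1
    refine h1.congr' ?_
    filter_upwards [eventually_ge_atTop 1] with n hn
    rw [tsum_empty, Complex.zero_re, hrate n hn, Function.comp_apply]
    field_simp
    ring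
  · have h1 := ((tendsto_treeRate_of_lattice hp hlt hh hspan).comp hlog).const_mul (α / entropy p)
    rw [mul_zero] at h1
    refine h1.congr' ?_
    filter_upwards [eventually_ge_atTop 1] with n hn
    rw [(hasSum_fluctTerm_lattice hp hlt hh hspan hn hα).tsum_eq, Complex.ofReal_re, hrate n hn,
      Function.comp_apply]
    field_simp
    ring

end Asymptotics

/-! ### The collision tree, path by path -/

section Paths

variable {d : ℕ}

/-- The number of users, among the `n` users at the root, who choose a branch in `A`. -/
def branchCount (A : Finset (Fin d)) (n : ℕ) (ω : Choices d) : ℕ :=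
  ((Finset.range n).filter fun i => ω ([], i) ∈ A).card

lemma childLabel_eq_branchCount (n : ℕ) (ω : Choices d) (j : Fin d) :
    childLabel n ω j = branchCount {j} n ω := by
  simp [childLabel, branchCount]

lemma branchCount_eq_sum (A : Finset (Fin d)) (n : ℕ) (ω : Choices d) :
    branchCount A n ω = ∑ j ∈ A, childLabel n ω j := by
  have h := Finset.card_eq_sum_card_fiberwise (s := (Finset.range n).filter fun i => ω ([], i) ∈ A)
    (f := fun i => ω ([], i)) (t := A) (fun i hi => (Finset.mem_filter.1 hi).2)
  rw [branchCount, h]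
  refine Finset.sum_congr rfl fun j hj => ?_
  rw [childLabel, Finset.filter_filter]
  congr 1
  refine Finset.filter_congr fun i _ => ?_
  constructor
  · exact fun h => h.2
  · exact fun h => ⟨h ▸ hj, h⟩

lemma branchCount_le (A : Finset (Fin d)) (n : ℕ) (ω : Choices d) : branchCount A n ω ≤ n :=
  (Finset.card_filter_le _ _).trans_eq (Finset.card_range n)

lemma childLabel_le (n : ℕ) (ω : Choices d) (j : Fin d) : childLabel n ω j ≤ n :=
  (Finset.card_filter_le _ _).trans_eq (Finset.card_range n)

lemma branchCount_succ (A : Finset (Fin d)) (n : ℕ) (ω : Choices d) :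
    branchCount A (n + 1) ω = branchCount A n ω + if ω ([], n) ∈ A then 1 else 0 := by
  rw [branchCount, branchCount, Finset.range_add_one, Finset.filter_insert]
  split_ifs with h
  · rw [Finset.card_insert_of_notMem (by simp)]
  · rfl

lemma sum_childLabel (n : ℕ) (ω : Choices d) : ∑ j, childLabel n ω j = n := by
  rw [← branchCount_eq_sum]; simp [branchCount]

lemma sum_lt_add_sum_ge (I : Fin d → ℕ) (k : ℕ) :
    ∑ j with j.val < k, I j + ∑ j with k ≤ j.val, I j = ∑ j, I j := by
  rw [← Finset.sum_filter_add_sum_filter_not Finset.univ (fun j : Fin d => j.val < k)]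
  simp_rw [not_lt]

lemma lastSlot_mem {n : ℕ} (hd : 1 ≤ d) {I : Fin d → ℕ} (hI : ∑ j, I j = n) :
    1 ≤ lastSlot n I ∧ lastSlot n I ≤ d ∧ n - 1 ≤ ∑ j with j.val < lastSlot n I, I j := by
  refine Nat.sInf_mem (s := {k : ℕ | 1 ≤ k ∧ k ≤ d ∧ n - 1 ≤ ∑ j with j.val < k, I j})
    ⟨d, hd, le_rfl, ?_⟩
  rw [Finset.filter_true_of_mem fun j _ => j.2, hI]
  exact Nat.sub_le n 1

/-- A slot lies before the last one exactly if at least two users remain. -/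
lemma lt_lastSlot_iff {n : ℕ} (hn : 2 ≤ n) (hd : 1 ≤ d) {I : Fin d → ℕ} (hI : ∑ j, I j = n)
    (k : ℕ) : k < lastSlot n I ↔ 2 ≤ ∑ j with k ≤ j.val, I j := by
  have h0 := sum_lt_add_sum_ge I k
  obtain ⟨h1, h2, h3⟩ := lastSlot_mem hd hI
  constructor
  · intro hk
    rcases Nat.eq_zero_or_pos k with rfl | hk0
    · simpa [hI] using hn
    · have h4 := Nat.notMem_of_lt_sInf hk
      simp only [Set.mem_ofPred_eq, not_and] at h4
      have := h4 hk0 (hk.le.trans h2)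
      omega
  · intro h
    by_contra! hk
    have : ∑ j with j.val < lastSlot n I, I j ≤ ∑ j with j.val < k, I j :=
      Finset.sum_le_sum_of_subset fun j hj => by
        simp only [Finset.mem_filter, Finset.mem_univ, true_and] at hj ⊢
        omega
    omega

lemma criUpTo_of_le_one {n : ℕ} (hn : n ≤ 1) (t : ℕ) (ω : Choices d) : criUpTo t n ω = 1 := by
  cases t <;> simp [criUpTo, hn]

lemma criUpTo_le_succ (t : ℕ) : ∀ (n : ℕ) (ω : Choices d), criUpTo t n ω ≤ criUpTo (t + 1) n ω := by
  induction t with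
  | zero =>
    intro n ω
    by_cases hn : n ≤ 1
    · rw [criUpTo_of_le_one hn, criUpTo_of_le_one hn]
    · simp [criUpTo, hn]
  | succ t ih =>
    intro n ω
    by_cases hn : n ≤ 1
    · rw [criUpTo_of_le_one hn, criUpTo_of_le_one hn]
    · rw [criUpTo, criUpTo, if_neg hn, if_neg hn]
      gcongr
      exact ih _ _

lemma exists_criUpTo_le (t : ℕ) : ∃ B : ℕ, ∀ (n : ℕ) (ω : Choices d), criUpTo t n ω ≤ B := by
  induction t with
  | zero => exact ⟨1, fun n ω => by rw [criUpTo]; split_ifs <;> simp⟩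
  | succ t ih =>
    obtain ⟨B, hB⟩ := ih
    refine ⟨1 + d * B, fun n ω => ?_⟩
    rw [criUpTo]
    split_ifs with h1 h2
    · omega
    all_goals
      have : ∑ j with j.val < lastSlot n (childLabel n ω),
          criUpTo t (childLabel n ω j) (subtree j ω) ≤ d * B := by
        refine (Finset.sum_le_card_nsmul _ _ B fun j _ => hB _ _).trans ?_
        rw [smul_eq_mul]
        gcongr
        exact (Finset.card_filter_le _ _).trans_eq (by simp)
      omega

/-- The recursion for the length minus one, which is additive over all subtrees: a subtree whose
root has at most one user contributes nothing, skipped or not, and the own cost of a node counts the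
slots, other than the last possible one, before which at least two users remain. -/
lemma criUpTo_succ_sub_one (hd : 1 ≤ d) (t n : ℕ) (ω : Choices d) :
    (criUpTo (t + 1) n ω : ℝ) - 1 =
      ∑ k ∈ Finset.range (d - 1),
        (if 2 ≤ branchCount (Finset.univ.filter fun j => k ≤ j.val) n ω then (1 : ℝ) else 0) +
      ∑ j, ((criUpTo t (childLabel n ω j) (subtree j ω) : ℝ) - 1) := by
  by_cases hn : n ≤ 1
  · rw [criUpTo_of_le_one hn, Finset.sum_eq_zero, Finset.sum_eq_zero]
    · simp
    · intro j _
      rw [criUpTo_of_le_one ((childLabel_le n ω j).trans hn)]; simp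
    · intro k _
      rw [if_neg]
      have := branchCount_le (Finset.univ.filter fun j : Fin d => k ≤ j.val) n ω
      omega
  have hn2 : 2 ≤ n := by omega
  have hI := sum_childLabel n ω
  set M := lastSlot n (childLabel n ω) with hM
  obtain ⟨h1, h2, h3⟩ := lastSlot_mem hd hI
  rw [← hM] at h1 h2 h3
  have hcount : ∑ k ∈ Finset.range (d - 1),
        (if 2 ≤ branchCount (Finset.univ.filter fun j => k ≤ j.val) n ω then (1 : ℝ) else 0) =
      min M (d - 1) := by
    simp_rw [branchCount_eq_sum, ← lt_lastSlot_iff hn2 hd hI, ← hM]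
    rw [Finset.sum_boole]
    norm_cast
    rw [show (Finset.range (d - 1)).filter (fun k => k < M) = Finset.range (min M (d - 1)) by
      ext k; simp; omega, Finset.card_range]
  -- the skipped subtrees have at most one user at their roots
  have hkids : ∑ j, ((criUpTo t (childLabel n ω j) (subtree j ω) : ℝ) - 1) =
      ∑ j with j.val < M, (criUpTo t (childLabel n ω j) (subtree j ω) : ℝ) - M := by
    rw [← Finset.sum_filter_add_sum_filter_not Finset.univ (fun j : Fin d => j.val < M),
      Finset.sum_sub_distrib, Finset.sum_eq_zero (s := Finset.univ.filter
        fun j : Fin d => ¬ j.val < M)]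
    · have : (Finset.univ.filter fun j : Fin d => j.val < M).card = M := by
        rw [Fin.card_filter_val_lt]
        exact min_eq_right h2
      simp [this]
    · intro j hj
      rw [criUpTo_of_le_one]
      · simp
      · have h4 := sum_lt_add_sum_ge (childLabel n ω) M
        have h5 : childLabel n ω j ≤ ∑ j with M ≤ j.val, childLabel n ω j :=
          Finset.single_le_sum (f := childLabel n ω) (fun _ _ => Nat.zero_le _) (by simpa using hj)
        omega
  rw [hcount, hkids, criUpTo, if_neg hn, ← hM]
  push_cast
  have : (if M < d then (1 : ℝ) else 0) = min (M : ℝ) ((d - 1 : ℕ) : ℝ) - M + 1 := by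
    rw [← Nat.cast_min]
    split_ifs with h
    · rw [min_eq_left (by omega)]; ring
    · have hMd : M = d := by omega
      rw [hMd, min_eq_right (by omega), Nat.cast_sub hd]; simp
  rw [this]
  ring

end Paths

/-! ### The mean length -/

section Mean

variable {d : ℕ} {p : Fin d → ℝ}

lemma isProbabilityMeasure_splitLaw (hp : p ∈ stdSimplex ℝ (Fin d)) :
    IsProbabilityMeasure (splitLaw p) := by
  refine ⟨?_⟩
  simp only [splitLaw, Measure.finsetSum_apply, Measure.smul_apply, measure_univ, smul_eq_mul,
    mul_one]
  rw [← ENNReal.ofReal_sum_of_nonneg fun j _ => hp.1 j, hp.2, ENNReal.ofReal_one]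

lemma isProbabilityMeasure_choiceLaw (hp : p ∈ stdSimplex ℝ (Fin d)) :
    IsProbabilityMeasure (choiceLaw p) := by
  have := isProbabilityMeasure_splitLaw hp
  unfold choiceLaw
  infer_instance

/-- Functions of disjoint sets of choices are independent. -/
lemma indepFun_of_disjoint (hp : p ∈ stdSimplex ℝ (Fin d)) {β γ : Type*} [MeasurableSpace β]
    [MeasurableSpace γ] {S T : Set (List (Fin d) × ℕ)} (hST : Disjoint S T)
    {f : Choices d → β} {g : Choices d → γ}
    (hf : Measurable[⨆ v ∈ S, MeasurableSpace.comap (fun ω : Choices d => ω v) inferInstance] f)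
    (hg : Measurable[⨆ v ∈ T, MeasurableSpace.comap (fun ω : Choices d => ω v) inferInstance] g) :
    ProbabilityTheory.IndepFun f g (choiceLaw p) := by
  have := isProbabilityMeasure_splitLaw hp
  have h1 : ProbabilityTheory.iIndepFun (fun v (ω : Choices d) => ω v) (choiceLaw p) :=
    ProbabilityTheory.iIndepFun_infinitePi (X := fun _ x => x) fun _ => measurable_id
  have h2 := ProbabilityTheory.indep_iSup_of_disjoint
    (fun v => (measurable_pi_apply v).comap_le) h1.iIndep hST
  rw [ProbabilityTheory.IndepFun_iff_Indep]
  exact ProbabilityTheory.indep_of_indep_of_le_left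
    (ProbabilityTheory.indep_of_indep_of_le_right h2 hg.comap_le) hf.comap_le

lemma measurable_apply_iSup {S : Set (List (Fin d) × ℕ)} {v : List (Fin d) × ℕ} (hv : v ∈ S) :
    Measurable[⨆ v ∈ S, MeasurableSpace.comap (fun ω : Choices d => ω v) inferInstance]
      (fun ω : Choices d => ω v) :=
  measurable_iff_comap_le.2
    (le_iSup₂ (f := fun v (_ : v ∈ S) =>
      MeasurableSpace.comap (fun ω : Choices d => ω v) inferInstance) v hv)

lemma measurable_choices {Ω : Type*} {mΩ : MeasurableSpace Ω} {f : Ω → Choices d}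
    (hf : ∀ v, Measurable fun ω => f ω v) : Measurable f :=
  measurable_pi_iff.2 hf

lemma measurable_card_filter {Ω : Type*} {mΩ : MeasurableSpace Ω} {X : ℕ → Ω → Fin d} {n : ℕ}
    (hX : ∀ i < n, Measurable (X i)) (A : Finset (Fin d)) :
    Measurable fun ω => ((Finset.range n).filter fun i => X i ω ∈ A).card := by
  simp_rw [Finset.card_filter]
  refine Finset.measurable_sum _ fun i hi => ?_
  exact (Measurable.of_discrete (f := fun x : Fin d => if x ∈ A then 1 else 0)).comp
    (hX i (Finset.mem_range.1 hi))

lemma measurable_branchCount (A : Finset (Fin d)) (n : ℕ) : Measurable (branchCount A n) :=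
  measurable_card_filter (X := fun i (ω : Choices d) => ω ([], i))
    (fun _ _ => measurable_pi_apply _) A

lemma measurable_childLabel (n : ℕ) (j : Fin d) :
    Measurable fun ω : Choices d => childLabel n ω j := by
  simp_rw [childLabel_eq_branchCount]
  exact measurable_branchCount _ n

lemma measurable_subtree (j : Fin d) : Measurable (subtree j) :=
  measurable_pi_iff.2 fun _ => measurable_pi_apply _

lemma measurable_criUpTo (t : ℕ) : ∀ n, Measurable (criUpTo (d := d) t n) := by
  induction t with
  | zero => exact fun n => measurable_const
  | succ t ih =>
    intro n
    change Measurable fun ω : Choices d => criUpTo (t + 1) n ω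
    simp only [criUpTo]
    split_ifs with hn
    · exact measurable_const
    have hI : Measurable fun ω : Choices d => childLabel n ω :=
      measurable_pi_iff.2 fun j => measurable_childLabel n j
    have hpair : Measurable fun q : (Fin d → ℕ) × Choices d =>
        (if lastSlot n q.1 < d then 1 else 0) +
          ∑ j with j.val < lastSlot n q.1, criUpTo t (q.1 j) (subtree j q.2) := by
      refine measurable_from_prod_countable_right fun I => ?_
      have hsum : Measurable fun ω : Choices d =>
          ∑ j with j.val < lastSlot n I, criUpTo t (I j) (subtree j ω) :=
        Finset.measurable_sum _ fun j _ => (ih (I j)).comp (measurable_subtree j)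
      exact hsum.const_add (if lastSlot n I < d then 1 else 0)
    have hcomp := hpair.comp (hI.prodMk measurable_id)
    simpa only [Function.comp_def, id] using hcomp

lemma integral_ite_mem (hp : p ∈ stdSimplex ℝ (Fin d)) (A : Finset (Fin d))
    (v : List (Fin d) × ℕ) :
    ∫ ω, (if ω v ∈ A then (1 : ℝ) else 0) ∂(choiceLaw p) = ∑ j ∈ A, p j := by
  have := isProbabilityMeasure_splitLaw hp
  have h1 : (choiceLaw p).map (fun ω => ω v) = splitLaw p := Measure.infinitePi_map_eval _ v
  have h2 := integral_map (μ := choiceLaw p) (φ := fun ω : Choices d => ω v)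
    (f := fun x : Fin d => if x ∈ A then (1 : ℝ) else 0) (measurable_pi_apply v).aemeasurable
    (Measurable.of_discrete).aestronglyMeasurable
  rw [← h2, h1, splitLaw, integral_finsetSum_measure fun j _ => ?_]
  · simp_rw [integral_smul_measure, integral_dirac, smul_eq_mul, mul_ite, mul_one, mul_zero]
    rw [Finset.sum_ite_mem, Finset.univ_inter]
    exact Finset.sum_congr rfl fun j _ => ENNReal.toReal_ofReal (hp.1 j)
  · exact (integrable_dirac (by simp)).smul_measure ENNReal.ofReal_ne_top

lemma integrable_of_abs_le (hp : p ∈ stdSimplex ℝ (Fin d)) {f : Choices d → ℝ} (hf : Measurable f)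
    {B : ℝ} (hB : ∀ ω, |f ω| ≤ B) : Integrable f (choiceLaw p) := by
  have := isProbabilityMeasure_choiceLaw hp
  exact .of_bound hf.aestronglyMeasurable B (Eventually.of_forall hB)

lemma integrable_comp_branchCount (hp : p ∈ stdSimplex ℝ (Fin d)) (A : Finset (Fin d)) (n : ℕ)
    (f : ℕ → ℝ) : Integrable (fun ω => f (branchCount A n ω)) (choiceLaw p) := by
  refine integrable_of_abs_le hp ((Measurable.of_discrete (f := f)).comp
    (measurable_branchCount A n)) (B := ∑ m ∈ Finset.range (n + 1), |f m|) fun ω => ?_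
  exact Finset.single_le_sum (f := fun m => |f m|) (fun _ _ => abs_nonneg _)
    (Finset.mem_range.2 (Nat.lt_succ_of_le (branchCount_le A n ω)))

/-- The factorial moments of the binomial distribution. -/
lemma integral_choose_branchCount (hp : p ∈ stdSimplex ℝ (Fin d)) (A : Finset (Fin d)) (n : ℕ) :
    ∀ i : ℕ, ∫ ω, ((branchCount A n ω).choose i : ℝ) ∂(choiceLaw p) =
      n.choose i * (∑ j ∈ A, p j) ^ i := by
  have := isProbabilityMeasure_choiceLaw hp
  induction n with
  | zero =>
    intro i
    rcases i with _ | i <;> simp [branchCount]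
  | succ n ih =>
    intro i
    rcases i with _ | i
    · simp
    have hind : ProbabilityTheory.IndepFun
        (fun ω : Choices d => if ω ([], n) ∈ A then (1 : ℝ) else 0)
        (fun ω => ((branchCount A n ω).choose i : ℝ)) (choiceLaw p) := by
      refine indepFun_of_disjoint hp (S := {([], n)}) (T := {v | v.2 < n}) ?_ ?_ ?_
      · simp
      · exact (Measurable.of_discrete (f := fun x : Fin d => if x ∈ A then (1 : ℝ) else 0)).comp
          (measurable_apply_iSup rfl)
      · exact (Measurable.of_discrete (f := fun m : ℕ => (m.choose i : ℝ))).comp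
          (measurable_card_filter (fun _ hi => measurable_apply_iSup hi) A)
    have hX : Measurable fun ω : Choices d => if ω ([], n) ∈ A then (1 : ℝ) else 0 :=
      (Measurable.of_discrete (f := fun x : Fin d => if x ∈ A then (1 : ℝ) else 0)).comp
          (measurable_pi_apply _)
    have hY := integrable_comp_branchCount hp A n fun m => (m.choose i : ℝ)
    have hmul := hind.integral_fun_mul_eq_mul_integral hX.aestronglyMeasurable
      hY.aestronglyMeasurable
    have hXY : Integrable (fun ω => (if ω ([], n) ∈ A then (1 : ℝ) else 0) *
        ((branchCount A n ω).choose i : ℝ)) (choiceLaw p) :=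
      hind.integrable_mul (integrable_of_abs_le hp hX (B := 1)
      fun ω => by split_ifs <;> simp) hY
    have hstep : ∀ ω, ((branchCount A (n + 1) ω).choose (i + 1) : ℝ) =
        ((branchCount A n ω).choose (i + 1) : ℝ) +
          (if ω ([], n) ∈ A then (1 : ℝ) else 0) * ((branchCount A n ω).choose i : ℝ) := by
      intro ω
      rw [branchCount_succ]
      split_ifs
      · rw [Nat.choose_succ_succ]; push_cast; ring
      · simp
    simp_rw [hstep]
    rw [integral_add (integrable_comp_branchCount hp A n fun m => (m.choose (i + 1) : ℝ)) hXY,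
      hmul, ih, ih, integral_ite_mem hp, Nat.choose_succ_succ n i]
    push_cast
    ring

/-- A linear combination, with coefficients `c`, of the binomial coefficients of `n` from the second
on. -/
noncomputable def chooseSum (c : ℕ → ℝ) (n : ℕ) : ℝ :=
  ∑ i ∈ Finset.Icc 2 n, (n.choose i : ℝ) * c i

lemma chooseSum_eq_of_le {m n : ℕ} (h : m ≤ n) (c : ℕ → ℝ) :
    chooseSum c m = ∑ i ∈ Finset.Icc 2 n, (m.choose i : ℝ) * c i := by
  refine Finset.sum_subset (Finset.Icc_subset_Icc_right h) fun i hi hi' => ?_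
  rw [Finset.mem_Icc] at hi hi'
  rw [Nat.choose_eq_zero_of_lt (by omega)]
  simp

lemma chooseSum_one (n : ℕ) :
    chooseSum (fun i => (-1) ^ i * ((i : ℝ) - 1)) n = if 2 ≤ n then 1 else 0 := by
  rw [← binomCollision_one, chooseSum, binomCollision]
  simp

lemma integral_chooseSum_branchCount (hp : p ∈ stdSimplex ℝ (Fin d)) (A : Finset (Fin d)) (n : ℕ)
    (c : ℕ → ℝ) :
    ∫ ω, chooseSum c (branchCount A n ω) ∂(choiceLaw p) =
      chooseSum (fun i => c i * (∑ j ∈ A, p j) ^ i) n := by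
  simp_rw [fun ω => chooseSum_eq_of_le (branchCount_le A n ω) c]
  rw [integral_finsetSum _ fun i _ =>
    integrable_comp_branchCount hp A n fun m => (m.choose i : ℝ) * c i]
  refine Finset.sum_congr rfl fun i _ => ?_
  rw [integral_mul_const, integral_choose_branchCount hp]
  ring

/-- Given its root label, a subtree has the law of the whole tree. -/
lemma integral_childLabel_subtree (hp : p ∈ stdSimplex ℝ (Fin d)) {F : ℕ → Choices d → ℝ}
    (hF : ∀ m, Measurable (F m)) {B : ℝ} (hB : ∀ m ω, |F m ω| ≤ B) (n : ℕ) (j : Fin d) :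
    Integrable (fun ω => F (childLabel n ω j) (subtree j ω)) (choiceLaw p) ∧
    ∫ ω, F (childLabel n ω j) (subtree j ω) ∂(choiceLaw p) =
      ∫ ω, (∫ ω', F (childLabel n ω j) ω' ∂(choiceLaw p)) ∂(choiceLaw p) := by
  have := isProbabilityMeasure_splitLaw hp
  have := isProbabilityMeasure_choiceLaw hp
  have hsub : (choiceLaw p).map (subtree j) = choiceLaw p :=
    Measure.map_infinitePi_infinitePi_of_inj (P := fun _ : List (Fin d) × ℕ => splitLaw p)
      (f := fun v : List (Fin d) × ℕ => (j :: v.1, v.2)) fun a b hab => by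
        simp only [Prod.mk.injEq, List.cons.injEq, true_and] at hab
        exact Prod.ext hab.1 hab.2
  -- decompose according to the value of the root label
  set X : ℕ → Choices d → ℝ := fun m ω => if childLabel n ω j = m then 1 else 0 with hX
  have hdec : ∀ G : ℕ → ℝ, ∀ ω, G (childLabel n ω j) = ∑ m ∈ Finset.range (n + 1), X m ω * G m := by
    intro G ω
    simp only [hX, ite_mul, one_mul, zero_mul]
    rw [Finset.sum_ite_eq, if_pos (Finset.mem_range.2 (Nat.lt_succ_of_le (childLabel_le n ω j)))]
  have hXm : ∀ m, Measurable (X m) := fun m =>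
    (Measurable.of_discrete (f := fun k : ℕ => if k = m then (1 : ℝ) else 0)).comp
      (measurable_childLabel n j)
  have hXi : ∀ m, Integrable (X m) (choiceLaw p) := fun m =>
    integrable_of_abs_le hp (hXm m) (B := 1) fun ω => by simp only [hX]; split_ifs <;> simp
  have hFm : ∀ m, Measurable fun ω => F m (subtree j ω) := fun m =>
    (hF m).comp (measurable_subtree j)
  have hFi : ∀ m, Integrable (fun ω => F m (subtree j ω)) (choiceLaw p) := fun m =>
    integrable_of_abs_le hp (hFm m) fun ω => hB m _
  have hind : ∀ m, ProbabilityTheory.IndepFun (X m) (fun ω => F m (subtree j ω)) (choiceLaw p) := by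
    intro m
    have h1 : ProbabilityTheory.IndepFun (fun ω : Choices d => branchCount {j} n ω) (subtree j)
        (choiceLaw p) := by
      refine indepFun_of_disjoint hp (S := {v | v.1 = []}) (T := {v | v.1 ≠ []}) ?_ ?_ ?_
      · exact Set.disjoint_left.2 fun v hv hv' => hv' hv
      · exact measurable_card_filter (X := fun i (ω : Choices d) => ω ([], i))
          (fun i _ => measurable_apply_iSup (by simp)) _
      · exact measurable_choices fun v => measurable_apply_iSup (by simp)
    have h2 := h1.comp (Measurable.of_discrete (f := fun k : ℕ => if k = m then (1 : ℝ) else 0))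
      (hF m)
    simp_rw [hX, childLabel_eq_branchCount]
    exact h2
  have hint : ∀ m ∈ Finset.range (n + 1),
      Integrable (fun ω => X m ω * F m (subtree j ω)) (choiceLaw p) := fun m _ =>
    (hind m).integrable_mul (hXi m) (hFi m)
  simp_rw [fun ω => hdec (fun m => F m (subtree j ω)) ω,
    fun ω => hdec (fun m => ∫ ω', F m ω' ∂(choiceLaw p)) ω]
  refine ⟨integrable_finsetSum _ hint, ?_⟩
  rw [integral_finsetSum _ hint, integral_finsetSum _ fun m _ => (hXi m).mul_const _]
  refine Finset.sum_congr rfl fun m _ => ?_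
  rw [(hind m).integral_fun_mul_eq_mul_integral (hXm m).aestronglyMeasurable
    (hFm m).aestronglyMeasurable, integral_mul_const]
  congr 1
  conv_rhs => rw [← hsub]
  rw [integral_map (measurable_subtree j).aemeasurable (hF m).aestronglyMeasurable]

/-- The coefficients of the mean of `criUpTo t` in the basis of binomial coefficients. -/
noncomputable def truncCoeff (p : Fin d → ℝ) (t i : ℕ) : ℝ :=
  (-1) ^ i * ((i : ℝ) - 1) *
    ((∑ m ∈ Finset.range t, (∑ j, p j ^ i) ^ m) * ∑ k ∈ Finset.range (d - 1), tailProb p k ^ i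
      - (∑ j, p j ^ i) ^ t)

lemma truncCoeff_succ (t i : ℕ) :
    truncCoeff p (t + 1) i =
      ∑ k ∈ Finset.range (d - 1), (-1) ^ i * ((i : ℝ) - 1) * tailProb p k ^ i +
        ∑ j, truncCoeff p t i * p j ^ i := by
  have hg : ∑ m ∈ Finset.range (t + 1), (∑ j, p j ^ i) ^ m =
      1 + (∑ j, p j ^ i) * ∑ m ∈ Finset.range t, (∑ j, p j ^ i) ^ m := by
    rw [Finset.sum_range_succ', Finset.mul_sum, pow_zero, add_comm]
    simp_rw [pow_succ']
  rw [truncCoeff, truncCoeff, hg, ← Finset.mul_sum, ← Finset.mul_sum]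
  ring

lemma chooseSum_add (c c' : ℕ → ℝ) (n : ℕ) :
    chooseSum (fun i => c i + c' i) n = chooseSum c n + chooseSum c' n := by
  simp_rw [chooseSum, mul_add]; exact Finset.sum_add_distrib

lemma chooseSum_finset_sum {ι : Type*} (s : Finset ι) (c : ι → ℕ → ℝ) (n : ℕ) :
    chooseSum (fun i => ∑ k ∈ s, c k i) n = ∑ k ∈ s, chooseSum (c k) n := by
  simp_rw [chooseSum, Finset.mul_sum]; exact Finset.sum_comm

lemma exists_abs_criUpTo_le (t : ℕ) :
    ∃ B : ℝ, ∀ (n : ℕ) (ω : Choices d), |(criUpTo t n ω : ℝ) - 1| ≤ B := by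
  obtain ⟨B, hB⟩ := exists_criUpTo_le (d := d) t
  refine ⟨B + 1, fun n ω => ?_⟩
  have h1 : (criUpTo t n ω : ℝ) ≤ B := by exact_mod_cast hB n ω
  have h2 : (0 : ℝ) ≤ criUpTo t n ω := Nat.cast_nonneg _
  rw [abs_le]
  constructor <;> linarith

lemma measurable_criUpTo_sub_one (t n : ℕ) :
    Measurable fun ω : Choices d => (criUpTo t n ω : ℝ) - 1 :=
  ((Measurable.of_discrete (f := fun k : ℕ => (k : ℝ))).comp (measurable_criUpTo t n)).sub_const 1

lemma integral_criUpTo_sub_one (hd : 1 ≤ d) (hp : p ∈ stdSimplex ℝ (Fin d)) (t : ℕ) :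
    ∀ n, ∫ ω, ((criUpTo t n ω : ℝ) - 1) ∂(choiceLaw p) = chooseSum (truncCoeff p t) n := by
  have := isProbabilityMeasure_choiceLaw hp
  induction t with
  | zero =>
    intro n
    have h1 : truncCoeff p 0 = fun i : ℕ => -((-1) ^ i * ((i : ℝ) - 1)) := by
      funext i; simp [truncCoeff]
    have h2 := chooseSum_one n
    rw [h1]
    simp only [chooseSum, mul_neg, Finset.sum_neg_distrib] at h2 ⊢
    rw [h2]
    simp only [criUpTo]
    rw [integral_const]
    by_cases hn : 2 ≤ n
    · simp [hn, show ¬ n ≤ 1 by omega]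
    · simp [hn, show n ≤ 1 by omega]
  | succ t ih =>
    intro n
    obtain ⟨B, hB⟩ := exists_abs_criUpTo_le (d := d) t
    have hsub := fun j => integral_childLabel_subtree hp
      (F := fun m ω => (criUpTo t m ω : ℝ) - 1) (fun m => measurable_criUpTo_sub_one t m) hB n j
    have hslot : ∀ k ∈ Finset.range (d - 1), Integrable (fun ω =>
        if 2 ≤ branchCount (Finset.univ.filter fun j : Fin d => k ≤ j.val) n ω then (1 : ℝ) else 0)
        (choiceLaw p) := fun k _ =>
      integrable_comp_branchCount hp _ n fun m => if 2 ≤ m then (1 : ℝ) else 0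
    simp_rw [criUpTo_succ_sub_one hd]
    rw [integral_add (integrable_finsetSum _ hslot)
      (integrable_finsetSum _ fun j _ => (hsub j).1), integral_finsetSum _ hslot,
      integral_finsetSum _ fun j _ => (hsub j).1]
    rw [funext (truncCoeff_succ (p := p) t), chooseSum_add, chooseSum_finset_sum,
      chooseSum_finset_sum]
    congr 1
    · refine Finset.sum_congr rfl fun k _ => ?_
      simp_rw [← chooseSum_one]
      rw [integral_chooseSum_branchCount hp]
      rfl
    · refine Finset.sum_congr rfl fun j _ => ?_
      rw [(hsub j).2]
      simp_rw [ih, childLabel_eq_branchCount]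
      rw [integral_chooseSum_branchCount hp]
      simp

/-- The exact formula for the mean length. -/
lemma meanCRI_eq (hd : 1 ≤ d) (hp : p ∈ stdSimplex ℝ (Fin d)) (hlt : ∀ j, p j < 1) (n : ℕ) :
    0 ≤ 1 + chooseSum (fun i => (-1) ^ i * ((i : ℝ) - 1) *
        (∑ k ∈ Finset.range (d - 1), tailProb p k ^ i) / (1 - ∑ j, p j ^ i)) n ∧
    meanCRI p n = ENNReal.ofReal (1 + chooseSum (fun i => (-1) ^ i * ((i : ℝ) - 1) *
        (∑ k ∈ Finset.range (d - 1), tailProb p k ^ i) / (1 - ∑ j, p j ^ i)) n) := by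
  have := isProbabilityMeasure_choiceLaw hp
  set L := 1 + chooseSum (fun i => (-1) ^ i * ((i : ℝ) - 1) *
        (∑ k ∈ Finset.range (d - 1), tailProb p k ^ i) / (1 - ∑ j, p j ^ i)) n with hL
  have hint : ∀ t, Integrable (fun ω => (criUpTo t n ω : ℝ)) (choiceLaw p) := by
    intro t
    obtain ⟨B, hB⟩ := exists_abs_criUpTo_le (d := d) t
    have := (integrable_of_abs_le hp (measurable_criUpTo_sub_one t n) (hB n)).add
      (integrable_const (1 : ℝ))
    exact this.congr (Eventually.of_forall fun ω => by simp)
  have hval : ∀ t, ∫ ω, (criUpTo t n ω : ℝ) ∂(choiceLaw p) = 1 + chooseSum (truncCoeff p t) n := by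
    intro t
    rw [← integral_criUpTo_sub_one hd hp, integral_sub (hint t) (integrable_const _)]
    simp
  have hlim : Tendsto (fun t => 1 + chooseSum (truncCoeff p t) n) atTop (𝓝 L) := by
    refine Tendsto.const_add _ (tendsto_finsetSum _ fun i hi => Tendsto.const_mul _ ?_)
    have hi2 : 2 ≤ i := (Finset.mem_Icc.1 hi).1
    have hr0 := sum_pow_nonneg hp i
    have hr1 := sum_pow_lt_one hp hlt hi2
    have h1 := (hasSum_geometric_of_lt_one hr0 hr1).tendsto_sum_nat.mul_const
      (∑ k ∈ Finset.range (d - 1), tailProb p k ^ i)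
    have h2 := (h1.sub (tendsto_pow_atTop_nhds_zero_of_lt_one hr0 hr1)).const_mul
      ((-1) ^ i * ((i : ℝ) - 1))
    beta_reduce
    rw [show (-1) ^ i * ((i : ℝ) - 1) * (∑ k ∈ Finset.range (d - 1), tailProb p k ^ i) /
      (1 - ∑ j, p j ^ i) = (-1) ^ i * ((i : ℝ) - 1) * ((1 - ∑ j, p j ^ i)⁻¹ *
        ∑ k ∈ Finset.range (d - 1), tailProb p k ^ i - 0) by ring]
    exact h2
  have hL0 : 0 ≤ L := ge_of_tendsto' hlim fun t => by
    rw [← hval]; exact integral_nonneg fun ω => Nat.cast_nonneg _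
  refine ⟨hL0, ?_⟩
  have hmono : Monotone fun t (ω : Choices d) => (criUpTo t n ω : ℝ≥0∞) := by
    refine monotone_nat_of_le_succ fun t ω => ?_
    show (criUpTo t n ω : ℝ≥0∞) ≤ (criUpTo (t + 1) n ω : ℝ≥0∞)
    exact_mod_cast criUpTo_le_succ t n ω
  have h1 : meanCRI p n = ⨆ t, ∫⁻ ω, (criUpTo t n ω : ℝ≥0∞) ∂(choiceLaw p) := by
    rw [← lintegral_iSup (f := fun t ω => (criUpTo t n ω : ℝ≥0∞))
      (fun t => (Measurable.of_discrete (f := fun k : ℕ => (k : ℝ≥0∞))).comp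
        (measurable_criUpTo t n)) hmono]
    simp only [meanCRI, criLength, ENat.toENNReal_iSup, ENat.toENNReal_coe]
  have h2 : ∀ t, ∫⁻ ω, (criUpTo t n ω : ℝ≥0∞) ∂(choiceLaw p) =
      ENNReal.ofReal (1 + chooseSum (truncCoeff p t) n) := by
    intro t
    rw [← hval, ofReal_integral_eq_lintegral_ofReal (hint t)
      (Eventually.of_forall fun ω => Nat.cast_nonneg _)]
    simp
  have h3 := tendsto_atTop_iSup fun s t hst =>
    lintegral_mono (μ := choiceLaw p) (hmono hst)
  rw [← h1] at h3
  simp_rw [h2] at h3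
  exact tendsto_nhds_unique h3 ((ENNReal.continuous_ofReal.tendsto _).comp hlim)

end Mean

/-! ### The asymptotic expansion of the mean length -/

section Expansion

variable {d : ℕ} {p : Fin d → ℝ}

lemma tailProb_nonneg (hp : p ∈ stdSimplex ℝ (Fin d)) (k : ℕ) : 0 ≤ tailProb p k :=
  Finset.sum_nonneg fun j _ => hp.1 j

lemma tailProb_le_one (hp : p ∈ stdSimplex ℝ (Fin d)) (k : ℕ) : tailProb p k ≤ 1 :=
  (Finset.sum_le_sum_of_subset_of_nonneg (Finset.filter_subset _ _) fun j _ _ => hp.1 j).trans_eq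
    hp.2

lemma toReal_meanCRI_eq (hd : 1 ≤ d) (hp : p ∈ stdSimplex ℝ (Fin d)) (hlt : ∀ j, p j < 1) (n : ℕ) :
    (meanCRI p n).toReal =
      1 + ∑ k ∈ Finset.range (d - 1), treeSum p (binomCollision n) (tailProb p k) := by
  obtain ⟨h0, h1⟩ := meanCRI_eq hd hp hlt n
  rw [h1, ENNReal.toReal_ofReal h0]
  simp_rw [treeSum_binomCollision hp hlt]
  rw [Finset.sum_comm]
  congr 1
  refine Finset.sum_congr rfl fun i _ => ?_
  rw [← Finset.mul_sum, ← Finset.sum_div, ← Finset.mul_sum]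

lemma tendsto_meanCRI_div_sub (hd : 1 ≤ d) (hp : p ∈ stdSimplex ℝ (Fin d)) (hlt : ∀ j, p j < 1) :
    Tendsto (fun n : ℕ => (meanCRI p n).toReal / n - (leadingTerm p + (fluct p n).re)) atTop
      (𝓝 0) := by
  have h1 : Tendsto (fun n : ℕ => ∑ k ∈ Finset.range (d - 1),
      (treeSum p (binomCollision n) (tailProb p k) -
        treeSum p poissonCollision (n * tailProb p k)) / n) atTop
      (𝓝 (∑ _k ∈ Finset.range (d - 1), 0)) :=
    tendsto_finsetSum _ fun k _ => tendsto_treeSum_binomCollision_sub hp hlt (tailProb_nonneg hp k)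
      (tailProb_le_one hp k)
  have h2 : Tendsto (fun n : ℕ => ∑ k ∈ Finset.range (d - 1),
      (treeSum p poissonCollision (n * tailProb p k) / n - (tailProb p k / entropy p +
        (∑' s : poles p, fluctTerm p n (tailProb p k) s).re))) atTop
      (𝓝 (∑ _k ∈ Finset.range (d - 1), 0)) :=
    tendsto_finsetSum _ fun k _ => tendsto_treeSum_poissonCollision hp hlt (tailProb_nonneg hp k)
  have h3 := ((tendsto_const_div_atTop_nhds_zero_nat (1 : ℝ)).add h1).add h2
  rw [Finset.sum_const_zero, add_zero, add_zero] at h3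
  refine h3.congr fun n => ?_
  have e : leadingTerm p = ∑ k ∈ Finset.range (d - 1), tailProb p k / entropy p := by
    rw [← Finset.sum_div]; rfl
  rw [toReal_meanCRI_eq hd hp hlt, e, fluct, Complex.re_sum, add_div, Finset.sum_div, add_assoc,
    ← Finset.sum_add_distrib, ← Finset.sum_add_distrib, add_sub_assoc, ← Finset.sum_sub_distrib]
  congr 1
  refine Finset.sum_congr rfl fun k _ => ?_
  ring

lemma fluct_eq_zero (hp : p ∈ stdSimplex ℝ (Fin d)) (hlt : ∀ j, p j < 1) (h : ¬ IsPeriodic p)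
    (n : ℕ) : fluct p n = 0 := by
  have : IsEmpty (poles p) := ⟨fun s => h (isPeriodic_of_mem_poles hp hlt s.2)⟩
  simp [fluct]

end Expansion

/-! ### The minimizer -/

section Minimizer

variable {d : ℕ}

lemma pBi_pos (j : Fin d) : 0 < pBi d j := by
  unfold pBi; positivity

lemma pBi_lt_one (hd : 2 ≤ d) (j : Fin d) : pBi d j < 1 :=
  pow_lt_one₀ (by norm_num) (by norm_num) (by omega)

lemma sum_range_half_pow (n : ℕ) :
    ∑ j ∈ Finset.range n, (1 / 2 : ℝ) ^ (j + 1) = 1 - (1 / 2) ^ n := by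
  induction n with
  | zero => simp
  | succ n ih => rw [Finset.sum_range_succ, ih]; ring

lemma sum_pBi_lt {k : ℕ} (hk : k < d) :
    ∑ j with j.val < k, pBi d j = 1 - (1 / 2 : ℝ) ^ k := by
  rw [← sum_range_half_pow, Finset.sum_filter]
  have := Fin.sum_univ_eq_sum_range
    (fun j => if j < k then (1 / 2 : ℝ) ^ min (j + 1) (d - 1) else 0) d
  simp only [pBi]
  rw [this, ← Finset.sum_filter]
  have e : (Finset.range d).filter (fun j => j < k) = Finset.range k := by
    ext j; simp; omega
  rw [e]
  refine Finset.sum_congr rfl fun j hj => ?_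
  have := Finset.mem_range.1 hj
  rw [min_eq_left (by omega)]

lemma sum_pBi (hd : 2 ≤ d) : ∑ j, pBi d j = 1 := by
  obtain ⟨m, rfl⟩ : ∃ m, d = m + 1 := ⟨d - 1, by omega⟩
  rw [← Finset.sum_filter_add_sum_filter_not Finset.univ (fun j : Fin (m + 1) => j.val < m),
    sum_pBi_lt (Nat.lt_succ_self m)]
  have e : (Finset.univ.filter fun j : Fin (m + 1) => ¬ j.val < m) = {Fin.last m} := by
    ext j
    simp only [Finset.mem_filter, Finset.mem_univ, true_and, Finset.mem_singleton, Fin.ext_iff,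
      Fin.val_last]
    omega
  rw [e, Finset.sum_singleton]
  simp [pBi]

lemma pBi_mem_stdSimplex (hd : 2 ≤ d) : pBi d ∈ stdSimplex ℝ (Fin d) :=
  ⟨fun j => (pBi_pos j).le, sum_pBi hd⟩

lemma tailProb_pBi {k : ℕ} (hk : k < d - 1) : tailProb (pBi d) k = (1 / 2 : ℝ) ^ k := by
  have h1 := Finset.sum_filter_add_sum_filter_not Finset.univ (fun j : Fin d => j.val < k) (pBi d)
  simp_rw [not_lt] at h1
  rw [sum_pBi_lt (by omega), sum_pBi (by omega)] at h1
  rw [tailProb]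
  linarith

lemma log_pBi (j : Fin d) :
    Real.log (pBi d j) = -((min (j.val + 1) (d - 1) : ℕ) * Real.log 2) := by
  rw [pBi, Real.log_pow, one_div, Real.log_inv]; ring

/-- Summation by parts: the sum of the tail probabilities is a truncated mean. -/
lemma sum_tailProb (p : Fin d → ℝ) :
    ∑ k ∈ Finset.range (d - 1), tailProb p k = ∑ j, p j * (min (j.val + 1) (d - 1) : ℕ) := by
  simp_rw [tailProb, Finset.sum_filter]
  rw [Finset.sum_comm]
  refine Finset.sum_congr rfl fun j _ => ?_
  rw [← Finset.sum_filter, Finset.sum_const, nsmul_eq_mul, mul_comm,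
    show (Finset.range (d - 1)).filter (fun k => k ≤ j.val) =
      Finset.range (min (j.val + 1) (d - 1)) by ext k; simp; omega, Finset.card_range]

lemma neg_sum_mul_log_pBi (p : Fin d → ℝ) :
    -∑ j, p j * Real.log (pBi d j) = Real.log 2 * ∑ k ∈ Finset.range (d - 1), tailProb p k := by
  rw [sum_tailProb, Finset.mul_sum, ← Finset.sum_neg_distrib]
  refine Finset.sum_congr rfl fun j _ => ?_
  rw [log_pBi]; ring

/-- Gibbs' inequality. -/
lemma entropy_le_neg_sum_mul_log {p q : Fin d → ℝ} (hp : p ∈ stdSimplex ℝ (Fin d))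
    (hq : q ∈ stdSimplex ℝ (Fin d)) (hq0 : ∀ j, 0 < q j) :
    entropy p ≤ -∑ j, p j * Real.log (q j) := by
  have key : ∀ j, p j * Real.log (q j) - p j * Real.log (p j) ≤ q j - p j := by
    intro j
    rcases (hp.1 j).eq_or_lt with h0 | h0
    · rw [← h0]; simpa using (hq0 j).le
    · have h1 := Real.log_le_sub_one_of_pos (div_pos (hq0 j) h0)
      rw [Real.log_div (hq0 j).ne' h0.ne'] at h1
      calc _ = p j * (Real.log (q j) - Real.log (p j)) := by ring
        _ ≤ p j * (q j / p j - 1) := by gcongr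
        _ = _ := by field_simp
  have := Finset.sum_le_sum fun j (_ : j ∈ Finset.univ) => key j
  rw [Finset.sum_sub_distrib, Finset.sum_sub_distrib, hp.2, hq.2] at this
  rw [entropy]
  linarith

lemma leadingTerm_pBi (hd : 2 ≤ d) : leadingTerm (pBi d) = 1 / Real.log 2 := by
  have h := entropy_pos (pBi_mem_stdSimplex hd) (pBi_lt_one hd)
  rw [entropy, neg_sum_mul_log_pBi] at h
  rw [leadingTerm, neg_sum_mul_log_pBi]
  have h2 : 0 < Real.log 2 := Real.log_pos one_lt_two
  have : 0 < ∑ k ∈ Finset.range (d - 1), tailProb (pBi d) k := by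
    by_contra! hneg
    nlinarith
  field_simp

lemma one_div_log_two_le_leadingTerm {p : Fin d → ℝ} (hd : 2 ≤ d)
    (hp : p ∈ stdSimplex ℝ (Fin d)) (hlt : ∀ j, p j < 1) : 1 / Real.log 2 ≤ leadingTerm p := by
  have h := entropy_pos hp hlt
  have h1 := entropy_le_neg_sum_mul_log hp (pBi_mem_stdSimplex hd) pBi_pos
  rw [neg_sum_mul_log_pBi] at h1
  have h2 : 0 < Real.log 2 := Real.log_pos one_lt_two
  change _ ≤ _ / entropy p
  rw [div_le_div_iff₀ h2 h]
  linarith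

/-! ### The fluctuation at the minimizer -/

lemma logSubgroup_pBi (hd : 2 ≤ d) : logSubgroup (pBi d) = AddSubgroup.closure {Real.log 2} := by
  refine le_antisymm ((AddSubgroup.closure_le _).2 ?_) ((AddSubgroup.closure_le _).2 ?_)
  · rintro _ ⟨j, -, rfl⟩
    rw [log_pBi, neg_neg, ← nsmul_eq_mul]
    exact AddSubgroup.nsmul_mem _ (AddSubgroup.subset_closure (Set.mem_singleton _)) _
  · rintro _ rfl
    have := neg_log_mem_logSubgroup (pBi_pos (⟨0, by omega⟩ : Fin d))
    rw [log_pBi, neg_neg, min_eq_left (by simp; omega)] at this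
    simpa using this

/-- The deviation from its mean `1` of the periodization of `collisionRate` with period `log 2`. -/
noncomputable def rateDeviation (x : ℝ) : ℝ :=
  Real.log 2 * ∑' i : ℤ, collisionRate (x - i * Real.log 2) - 1

lemma rateDeviation_sub_nat_mul (x : ℝ) (k : ℕ) :
    rateDeviation (x - k * Real.log 2) = rateDeviation x := by
  unfold rateDeviation
  congr 2
  rw [← (Equiv.addRight (k : ℤ)).tsum_eq (fun i : ℤ => collisionRate (x - i * Real.log 2))]
  refine tsum_congr fun i => ?_
  congr 1
  simp only [Equiv.coe_addRight]
  push_cast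
  ring

/-- The terms for different `k` have the same phase, as the tail probabilities are powers of
`1 / 2`. -/
lemma fluct_pBi (hd : 2 ≤ d) {n : ℕ} (hn : 1 ≤ n) :
    fluct (pBi d) n = ((1 / Real.log 2 * rateDeviation (Real.log n) : ℝ) : ℂ) := by
  have hn0 : (0 : ℝ) < n := by exact_mod_cast hn
  rw [fluct, ← leadingTerm_pBi hd, leadingTerm, Finset.sum_div, Finset.sum_mul, Complex.ofReal_sum]
  refine Finset.sum_congr rfl fun k hk => ?_
  have hk' := tailProb_pBi (Finset.mem_range.1 hk)
  rw [(hasSum_fluctTerm_lattice (pBi_mem_stdSimplex hd) (pBi_lt_one hd) (Real.log_pos one_lt_two)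
    (logSubgroup_pBi hd) hn (by rw [hk']; positivity)).tsum_eq]
  have hlog : Real.log (n * tailProb (pBi d) k) = Real.log n - k * Real.log 2 := by
    rw [hk', Real.log_mul hn0.ne' (by positivity), Real.log_pow, one_div, Real.log_inv]; ring
  have := rateDeviation_sub_nat_mul (Real.log n) k
  rw [← this, hlog]
  rfl

/-- The term of frequency `m` in the Fourier series of `rateDeviation`. -/
noncomputable def rateTerm (x : ℝ) (m : ℤ) : ℂ :=
  rateCoeff (Real.log 2) m *
    Complex.exp (-((2 * Real.pi * m / Real.log 2 * x : ℝ) * Complex.I))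

/-- The rate of decay of the Fourier coefficients of `rateDeviation`. -/
noncomputable def decayRate : ℝ := Real.exp (-(3 * Real.pi ^ 2 / (4 * Real.log 2)))

lemma decayRate_pos : 0 < decayRate := Real.exp_pos _

lemma decayRate_le : decayRate ≤ 1 / 20000 := by
  have h1 : (10 : ℝ) ≤ 3 * Real.pi ^ 2 / (4 * Real.log 2) := by
    have := Real.log_two_lt_d9
    have := Real.pi_gt_d2
    rw [le_div_iff₀ (by have := Real.log_pos one_lt_two; positivity)]
    nlinarith
  have h2 : (20000 : ℝ) ≤ Real.exp 10 := by
    have h3 := Real.exp_one_gt_d9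
    have h4 : Real.exp 10 = Real.exp 1 ^ 10 := by rw [← Real.exp_nat_mul]; norm_num
    rw [h4]
    calc (20000 : ℝ) ≤ 2.7182818283 ^ 10 := by norm_num
      _ ≤ _ := by gcongr
  calc decayRate ≤ Real.exp (-10) := Real.exp_le_exp.2 (by linarith)
    _ = (Real.exp 10)⁻¹ := Real.exp_neg 10
    _ ≤ 20000⁻¹ := by gcongr
    _ = _ := by norm_num

lemma norm_rateTerm (x : ℝ) (m : ℤ) : ‖rateTerm x m‖ = ‖rateCoeff (Real.log 2) m‖ := by
  rw [rateTerm, norm_mul, ← neg_mul, ← Complex.ofReal_neg, Complex.norm_exp_ofReal_mul_I, mul_one]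

lemma rateTerm_zero (x : ℝ) : rateTerm x 0 = 1 := by
  simp [rateTerm, rateCoeff_zero]

lemma hasSum_pow_natAbs {r : ℝ} (h0 : 0 ≤ r) (h1 : r < 1) :
    HasSum (fun m : ℤ => r ^ m.natAbs) ((1 + r) / (1 - r)) := by
  have hg := hasSum_geometric_of_lt_one h0 h1
  have h2 : HasSum (fun m : ℤ => r ^ m.natAbs) ((1 - r)⁻¹ + r * (1 - r)⁻¹) := by
    refine HasSum.of_nat_of_neg_add_one (by simpa using hg) ?_
    refine (hg.mul_left r).congr_fun fun n => ?_
    rw [Int.natAbs_neg, ← Nat.cast_succ, Int.natAbs_natCast, Nat.succ_eq_add_one, pow_succ']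
  convert h2 using 1
  ring

lemma norm_rateDeviation_sub_le (x : ℝ) (F : Finset ℤ) :
    ‖((1 + rateDeviation x : ℝ) : ℂ) - ∑ m ∈ F, rateTerm x m‖ ≤
      2 * ((1 + decayRate) / (1 - decayRate) - ∑ m ∈ F, decayRate ^ m.natAbs) := by
  have hl : 0 < Real.log 2 := Real.log_pos one_lt_two
  have hr1 : decayRate < 1 := decayRate_le.trans_lt (by norm_num)
  have hs : Summable (rateTerm x) :=
    .of_norm ((summable_norm_rateCoeff hl).congr fun m => (norm_rateTerm x m).symm)
  have hr := hasSum_pow_natAbs decayRate_pos.le hr1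
  have h1 : ((1 + rateDeviation x : ℝ) : ℂ) = ∑' m : ℤ, rateTerm x m := by
    have := tsum_collisionRate_eq hl x
    rw [rateDeviation, add_sub_cancel, this]
    rfl
  rw [h1, ← hs.sum_add_tsum_subtype_compl F, add_sub_cancel_left, ← hr.tsum_eq,
    ← hr.summable.sum_add_tsum_subtype_compl F, add_sub_cancel_left]
  refine tsum_of_norm_bounded ((hr.summable.subtype _).hasSum.mul_left 2) fun m => ?_
  rw [norm_rateTerm]
  exact norm_rateCoeff_le hl m

lemma abs_rateDeviation_le (x : ℝ) : |rateDeviation x| ≤ 1 / 4000 := by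
  have h := norm_rateDeviation_sub_le x {0}
  rw [Finset.sum_singleton, Finset.sum_singleton, rateTerm_zero, Int.natAbs_zero, pow_zero,
    Complex.ofReal_add, Complex.ofReal_one, add_sub_cancel_left, Complex.norm_real,
    Real.norm_eq_abs] at h
  refine h.trans ?_
  have h1 := decayRate_le
  have h2 := decayRate_pos
  rw [div_sub_one (by linarith), ← mul_div_assoc, div_le_iff₀ (by linarith)]
  linarith

lemma rateTerm_neg_one (x : ℝ) : rateTerm x (-1) = (starRingEnd ℂ) (rateTerm x 1) := by
  rw [rateTerm, rateTerm, map_mul, ← Complex.exp_conj, rateCoeff_eq, rateCoeff_eq, map_neg,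
    map_div₀, ← Complex.Gamma_conj]
  simp only [map_add, map_mul, map_neg, map_one, Complex.conj_ofReal, Complex.conj_I]
  congr 3 <;> push_cast <;> ring_nf

lemma abs_rateDeviation_sub_le (x : ℝ) :
    |rateDeviation x - 2 * (rateTerm x 1).re| ≤ 1 / 10 ^ 7 := by
  have h := norm_rateDeviation_sub_le x {0, 1, -1}
  rw [Finset.sum_insert (by decide), Finset.sum_insert (by decide), Finset.sum_singleton,
    Finset.sum_insert (by decide), Finset.sum_insert (by decide), Finset.sum_singleton,
    rateTerm_zero, rateTerm_neg_one, Complex.add_conj] at h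
  have e : ((1 + rateDeviation x : ℝ) : ℂ) - (1 + (2 * (rateTerm x 1).re : ℝ)) =
      ((rateDeviation x - 2 * (rateTerm x 1).re : ℝ) : ℂ) := by push_cast; ring
  rw [e, Complex.norm_real, Real.norm_eq_abs] at h
  refine h.trans ?_
  have h1 := decayRate_le
  have h2 := decayRate_pos
  simp only [Int.natAbs_zero, pow_zero, Int.natAbs_one, pow_one, Int.natAbs_neg]
  have h3 : (1 + decayRate) / (1 - decayRate) - (1 + (decayRate + decayRate)) =
      2 * decayRate ^ 2 / (1 - decayRate) := by
    have : 1 - decayRate ≠ 0 := by linarith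
    field_simp
    ring
  rw [h3, ← mul_div_assoc, div_le_iff₀ (by linarith)]
  nlinarith

/-- The numerical value is about `5.4 * 10 ^ (-7)`. -/
lemma le_norm_rateCoeff_one : 4 / 10 ^ 7 ≤ ‖rateCoeff (Real.log 2) 1‖ := by
  have hl0 : 0 < Real.log 2 := Real.log_pos one_lt_two
  have hl1 := Real.log_two_gt_d9
  have hl2 := Real.log_two_lt_d9
  have hp1 := Real.pi_gt_d4
  have hp2 := Real.pi_lt_d4
  set τ : ℝ := 2 * Real.pi / Real.log 2 with hτ
  have hτ1 : 9.06 ≤ τ := by rw [hτ, le_div_iff₀ hl0]; linarith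
  have hτ2 : τ ≤ 9.07 := by rw [hτ, div_le_iff₀ hl0]; linarith
  have e1 : (2 * Real.pi * (1 : ℤ) / Real.log 2 : ℝ) = τ := by rw [Int.cast_one, mul_one]
  have hn : ‖(-1 + τ * Complex.I : ℂ)‖ ^ 2 = 1 + τ ^ 2 := by
    rw [← Complex.normSq_eq_norm_sq, Complex.normSq_apply]; simp; ring
  rw [rateCoeff_eq, e1, norm_neg, norm_div]
  refine le_of_sq_le_sq ?_ (by positivity)
  rw [div_pow ‖Complex.Gamma (1 + τ * Complex.I)‖, hn,
    norm_Gamma_one_add_mul_I_sq (by linarith : τ ≠ 0)]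
  have hy0 : 0 < Real.pi * τ := by positivity
  -- the value is about `28.48`
  have hy : Real.pi * τ ≤ 29 := by nlinarith
  have hsinh : Real.sinh (Real.pi * τ) ≤ 1.97 * 10 ^ 12 := by
    have h1 : Real.exp (Real.pi * τ) ≤ 3.94 * 10 ^ 12 := by
      calc Real.exp (Real.pi * τ) ≤ Real.exp 29 := Real.exp_le_exp.2 hy
        _ = Real.exp 1 ^ 29 := by rw [← Real.exp_nat_mul]; norm_num
        _ ≤ 2.7182818286 ^ 29 := by
          have := Real.exp_one_lt_d9
          gcongr
        _ ≤ _ := by norm_num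
    rw [Real.sinh_eq]
    linarith [Real.exp_pos (-(Real.pi * τ))]
  have hs0 : 0 < Real.sinh (Real.pi * τ) := Real.sinh_pos_iff.2 hy0
  rw [div_div, le_div_iff₀ (by positivity)]
  calc (4 / 10 ^ 7 : ℝ) ^ 2 * (Real.sinh (Real.pi * τ) * (1 + τ ^ 2))
      ≤ (4 / 10 ^ 7 : ℝ) ^ 2 * (1.97 * 10 ^ 12 * (1 + 9.07 ^ 2)) := by gcongr
    _ ≤ 3.14 * 9.06 := by norm_num
    _ ≤ _ := by gcongr; linarith

lemma rateTerm_sub_nat_mul (x : ℝ) (k : ℕ) :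
    rateTerm (x + k * Real.log 2) 1 = rateTerm x 1 := by
  have hl : (Real.log 2 : ℂ) ≠ 0 := by
    exact_mod_cast (Real.log_pos one_lt_two).ne'
  have e : -((2 * Real.pi * (1 : ℤ) / Real.log 2 * (x + k * Real.log 2) : ℝ) * Complex.I) =
      -((2 * Real.pi * (1 : ℤ) / Real.log 2 * x : ℝ) * Complex.I) +
        ((-k : ℤ) : ℂ) * (2 * Real.pi * Complex.I) := by
    push_cast
    field_simp
    ring
  rw [rateTerm, rateTerm, e, Complex.exp_add, Complex.exp_int_mul_two_pi_mul_I, mul_one]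

lemma continuous_rateTerm (m : ℤ) : Continuous fun x => rateTerm x m := by
  unfold rateTerm; fun_prop

/-- Some `x` makes the first Fourier term positive. -/
lemma exists_rateTerm_one_eq : ∃ x, rateTerm x 1 = ‖rateCoeff (Real.log 2) 1‖ := by
  have hl : (Real.log 2 : ℂ) ≠ 0 := by
    exact_mod_cast (Real.log_pos one_lt_two).ne'
  have hpi : (Real.pi : ℂ) ≠ 0 := by exact_mod_cast Real.pi_ne_zero
  set c := rateCoeff (Real.log 2) 1 with hc
  refine ⟨c.arg * Real.log 2 / (2 * Real.pi), ?_⟩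
  rw [rateTerm, ← hc]
  have e : -((2 * Real.pi * (1 : ℤ) / Real.log 2 * (c.arg * Real.log 2 / (2 * Real.pi)) : ℝ) *
      Complex.I) = -(c.arg * Complex.I) := by
    push_cast
    field_simp
  calc c * Complex.exp _ = ‖c‖ * Complex.exp (c.arg * Complex.I) *
        Complex.exp (-(c.arg * Complex.I)) := by rw [e, Complex.norm_mul_exp_arg_mul_I]
    _ = ‖c‖ := by rw [mul_assoc, ← Complex.exp_add, add_neg_cancel, Complex.exp_zero, mul_one]

/-- The logarithms of the integers come arbitrarily close to every point modulo `log 2`. -/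
lemma tendsto_log_floor_sub (x : ℝ) :
    Tendsto (fun k : ℕ => Real.log ⌊2 ^ k * Real.exp x⌋₊ - k * Real.log 2) atTop (𝓝 x) := by
  have h2 : Tendsto (fun k : ℕ => (2 : ℝ) ^ k * Real.exp x) atTop atTop :=
    (tendsto_pow_atTop_atTop_of_one_lt one_lt_two).atTop_mul_const (Real.exp_pos x)
  have h3 := (tendsto_nat_floor_div_atTop (R := ℝ)).comp h2
  have h4 := ((Real.continuousAt_log one_ne_zero).tendsto.comp h3).add_const x
  rw [Real.log_one, zero_add] at h4
  refine h4.congr' ?_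
  filter_upwards [h2.eventually_ge_atTop 1] with k hk
  have hf : (0 : ℝ) < ⌊2 ^ k * Real.exp x⌋₊ := by
    exact_mod_cast Nat.floor_pos.2 hk
  simp only [Function.comp_apply]
  rw [Real.log_div hf.ne' (by positivity), Real.log_mul (by positivity) (Real.exp_pos x).ne',
    Real.log_exp, Real.log_pow]
  ring

lemma abs_re_fluct_pBi_le (hd : 2 ≤ d) {n : ℕ} (hn : 1 ≤ n) :
    |(fluct (pBi d) n).re| ≤ 1 / 10 ^ 3 := by
  have hl := Real.log_two_gt_d9
  rw [fluct_pBi hd hn, Complex.ofReal_re, abs_mul, abs_of_pos (by positivity), one_div,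
    inv_mul_le_iff₀ (by linarith)]
  have := abs_rateDeviation_le (Real.log n)
  linarith

lemma frequently_le_abs_re_fluct_pBi (hd : 2 ≤ d) :
    ∃ᶠ n : ℕ in atTop, 1 / 10 ^ 6 ≤ |(fluct (pBi d) n).re| := by
  obtain ⟨x, hx⟩ := exists_rateTerm_one_eq
  have hfloor : Tendsto (fun k : ℕ => ⌊(2 : ℝ) ^ k * Real.exp x⌋₊) atTop atTop :=
    tendsto_nat_floor_atTop.comp
      ((tendsto_pow_atTop_atTop_of_one_lt one_lt_two).atTop_mul_const (Real.exp_pos x))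
  refine hfloor.frequently (Eventually.frequently ?_)
  have h1 : Tendsto (fun k : ℕ => (rateTerm (Real.log ⌊(2 : ℝ) ^ k * Real.exp x⌋₊) 1).re) atTop
      (𝓝 ‖rateCoeff (Real.log 2) 1‖) := by
    have h := (Complex.continuous_re.comp (continuous_rateTerm 1)).continuousAt.tendsto.comp
      (tendsto_log_floor_sub x)
    simp only [Function.comp_def, hx, Complex.ofReal_re] at h
    refine h.congr fun k => ?_
    rw [← rateTerm_sub_nat_mul _ k, sub_add_cancel]
  have h2 := le_norm_rateCoeff_one
  have h3 : (3.99 : ℝ) / 10 ^ 7 < ‖rateCoeff (Real.log 2) 1‖ := lt_of_lt_of_le (by norm_num) h2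
  filter_upwards [h1.eventually_const_lt h3, hfloor.eventually_ge_atTop 1] with k hk hk1
  set n := ⌊(2 : ℝ) ^ k * Real.exp x⌋₊
  have hl := Real.log_two_lt_d9
  have hl0 : 0 < Real.log 2 := Real.log_pos one_lt_two
  have h4 := (abs_le.1 (abs_rateDeviation_sub_le (Real.log n))).1
  rw [fluct_pBi hd hk1, Complex.ofReal_re]
  refine le_trans ?_ (le_abs_self _)
  rw [one_div (Real.log 2), inv_mul_eq_div, le_div_iff₀ hl0]
  norm_num at hk h4 ⊢
  linarith

end Minimizer

end SICTA

theorem theorem1 (d : ℕ) (hd : 2 ≤ d) :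
    (∀ p : Fin d → ℝ, p ∈ stdSimplex ℝ (Fin d) → (∀ j, p j < 1) →
      -- the exact formula
      (∀ n : ℕ, SICTA.meanCRI p n ≠ ⊤ ∧
        (SICTA.meanCRI p n).toReal =
          1 + ∑ i ∈ Finset.Icc 2 n,
            (n.choose i : ℝ) *
              ((-1) ^ i * ((i : ℝ) - 1) *
                  (∑ k ∈ Finset.range (d - 1), SICTA.tailProb p k ^ i) /
                (1 - ∑ j, p j ^ i))) ∧
      -- the series defining the fluctuation converges and its value is real
      (∀ n : ℕ, 1 ≤ n → ∀ k < d - 1,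
        Summable fun s : SICTA.poles p => SICTA.fluctTerm p n (SICTA.tailProb p k) s) ∧
      (∀ n : ℕ, 1 ≤ n → (SICTA.fluct p n).im = 0) ∧
      -- the asymptotic expansion
      Tendsto
        (fun n : ℕ => (SICTA.meanCRI p n).toReal / n
          - (SICTA.leadingTerm p + (SICTA.fluct p n).re)) atTop (𝓝 0) ∧
      -- no fluctuation in the aperiodic case
      (¬ SICTA.IsPeriodic p → ∀ n : ℕ, 1 ≤ n → SICTA.fluct p n = 0)) ∧
    -- the minimizer of the leading term
    (SICTA.pBi d ∈ stdSimplex ℝ (Fin d) ∧ (∀ j, SICTA.pBi d j < 1) ∧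
      (∀ p : Fin d → ℝ, p ∈ stdSimplex ℝ (Fin d) → (∀ j, p j < 1) →
        SICTA.leadingTerm (SICTA.pBi d) ≤ SICTA.leadingTerm p) ∧
      SICTA.leadingTerm (SICTA.pBi d) = 1 / Real.log 2 ∧
      -- the size of the fluctuation at the minimizer
      (∀ n : ℕ, 1 ≤ n → |(SICTA.fluct (SICTA.pBi d) n).re| ≤ 1 / 10 ^ 3) ∧
      (∃ᶠ n : ℕ in atTop, 1 / 10 ^ 6 ≤ |(SICTA.fluct (SICTA.pBi d) n).re|)) := by
  have hd1 : 1 ≤ d := by omega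
  refine ⟨fun p hp hlt => ⟨fun n => ?_, fun n hn k _ => ?_, fun n hn => ?_, ?_, fun h n _ => ?_⟩,
    SICTA.pBi_mem_stdSimplex hd, SICTA.pBi_lt_one hd, fun p hp hlt => ?_, SICTA.leadingTerm_pBi hd,
    fun n hn => SICTA.abs_re_fluct_pBi_le hd hn, SICTA.frequently_le_abs_re_fluct_pBi hd⟩
  · obtain ⟨h0, h1⟩ := SICTA.meanCRI_eq hd1 hp hlt n
    rw [h1, ENNReal.toReal_ofReal h0]
    exact ⟨ENNReal.ofReal_ne_top, rfl⟩
  · exact SICTA.summable_fluctTerm hp hlt hn (SICTA.tailProb_nonneg hp k)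
  · rw [SICTA.fluct, Complex.im_sum]
    exact Finset.sum_eq_zero fun k _ =>
      SICTA.im_tsum_fluctTerm hp hlt hn (SICTA.tailProb_nonneg hp k)
  · exact SICTA.tendsto_meanCRI_div_sub hd1 hp hlt
  · exact SICTA.fluct_eq_zero hp hlt h n
  · rw [SICTA.leadingTerm_pBi hd]
    exact SICTA.one_div_log_two_le_leadingTerm hd hp hlt
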